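/- **Setting.** Consider $x(k+1)=Ax(k)+w(k)$, $z(k)=Cx(k)+v(k)$, $y(k)=z(k)+a(k)$, $k\ge 0$, with $x(k)\in\mathbb R^n$, $m$ sensors, real $A,C$, noises $w(k)\sim N(0,Q)$ i.i.d. and $v(k)\sim N(0,R)$ i.i.d., and $x(0)\sim N(0,\Sigma)$ independent of $\{w(k)\}$, where $Q,\Sigma\succeq0$ and $R\succ 0$. Primes denote conjugate transposes. Let $P(0|-1)=\Sigma$, $K(k)=P(k|k-1)C'(CP(k|k-1)C'+R)^{-1}$, $P(k)=P(k|k-1)-K(k)CP(k|k-1)$, $P(k+1|k)=AP(k)A'+Q$ be the Kalman recursion. Assume that $P=\lim_k P(k)$ exists and put $P_+=APA'+Q$, $K=P_+C'(CP_+C'+R)^{-1}$. Assume that $A-KCA=V\Pi V^{-1}$ with $\Pi=\mathrm{diag}(\pi_1,\dots,\pi_n)$, where the $\pi_j$ are distinct and none is an eigenvalue of $A$, and that $A$ is non-singular and all its eigenvalues have geometric multiplicity $1$; thus $A=TJT^{-1}$ with $T$ complex invertible and $J$ a Jordan form (ones above the diagonal) with exactly one block per eigenvalue. **The estimator.** Let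 $C_i$ be the $i$-th row of $C$ and let $G_i$ be the $n\times n$ matrix with rows $C_iA(A-\pi_jI)^{-1}$, $j=1,\dots,n$. Let $O_i$ be the observability matrix with rows $C_iTJ^t$, $0\le t<n$, let $\mathcal S_j=\{i: O_ie_j\ne0\}$, $H_i=\mathrm{diag}(\mathbb 1_{i\in\mathcal S_1},\dots,\mathbb 1_{i\in\mathcal S_n})$, and let $H$ be the matrix with the blocks $H_1,\dots,H_m$ stacked. Let $P_i$ be any invertible complex matrices with $P_iG_iT=H_i$. Let $L$ be the matrix with the blocks $G_i-\mathbf 1_nC_i$ stacked, $\tilde\Pi=\mathrm{diag}(\Pi,\dots,\Pi)$, $\tilde P=\mathrm{diag}(P_1,\dots,P_m)$; let $\tilde W$ be the solution of $\tilde W=\tilde\Pi\tilde W\tilde\Pi'+LQL'+R\otimes\mathbf 1_{n\times n}$ and $\tilde M=\tilde P\tilde W\tilde P'$. The local estimates are $\zeta_i(k+1)=\Pi\zeta_i(k)+\mathbf 1_ny_i(k+1)$, started at $\zeta_i(0)=\alpha_i+\beta_iy_i(0)$ with arbitrary fixed $\alpha_i,\beta_i\in\mathbb C^n$, and $\mathcal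 Y(k)$ is the vector with the blocks $P_i\zeta_i(k)$ stacked. Fix $\gamma>0$ and a real-linear subspace $\mathcal X$ with $\mathbb R^n\subseteq\mathcal X\subseteq\mathbb C^n$ (for instance $\mathbb R^n$ or $\mathbb C^n$). The estimate $\tilde x(k)=g_k(y(0:k))$ is the $\tilde x$-part of any minimizer, chosen as a function of $y(0:k)$, of $$\min_{\tilde x\in\mathcal X,\ \mu,\nu\in\mathbb C^{mn}}\ \tfrac12\mu'\tilde M^{-1}\mu+\gamma\|\nu\|_1\quad\text{subject to}\quad \mathcal Y(k)=HT^{-1}\tilde x+\mu+\nu .$$ (If $A$ is itself in Jordan form, take $T=I$.) **Notions.** The sparse observability index of $(A,C)$ is the largest $s\le m$ such that $(A,C_{\mathcal R\setminus\mathcal I})$ is observable for every set $\mathcal I\subseteq\mathcal R=\{1,\dots,m\}$ with $|\mathcal I|=s$. "$2p$-sparse observable" means that this index exists and is at least $2p$. An attack is $p$-sparse if there is a fixed set $\mathcal I$ of $p$ sensors with $\mathrm{supp}\,a(k)\subseteq\mathcal I$ for all $k\ge0$; it is otherwise arbitrary and may be random and depend on everything else. **Theorem.** If $(A,C)$ is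 $2p$-sparse observable, then the estimator is well defined (the Lyapunov equation has exactly one solution $\tilde W$, matrices $P_i$ as above exist, and for all data $\mathcal Y(k)\in\mathbb C^{mn}$ the convex program has a minimizer), and for every choice of the $P_i$ and of the minimizers it is secure against $p$-sparse attacks: there is a constant $B<\infty$, not depending on the attack, with $$\sup_{k}\ \mathbb E\,\big\|g_k(z(0:k))-g_k(y(0:k))\big\|_2^2\ \le\ B\qquad\text{for every } p\text{-sparse attack } a.$$ -/

import Mathlib

open MeasureTheory ProbabilityTheory Filter Topology Matrix
open scoped NNReal ENNReal Kronecker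

noncomputable section

namespace SecureEst

variable {m n : ℕ} {Ω : Type*}

/-! ### The plant, attacks and observability -/

/-- The state trajectory `x(0) = x0`, `x(k+1) = A x(k) + w(k)`. -/
def state (A : Matrix (Fin n) (Fin n) ℝ) (x0 : Ω → Fin n → ℝ) (w : ℕ → Ω → Fin n → ℝ) :
    ℕ → Ω → Fin n → ℝ
  | 0, ω => x0 ω
  | k + 1, ω => A *ᵥ state A x0 w k ω + w k ω

/-- The true measurements `z(k) = C x(k) + v(k)`. -/
def trueMeas (A : Matrix (Fin n) (Fin n) ℝ) (C : Matrix (Fin m) (Fin n) ℝ)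
    (x0 : Ω → Fin n → ℝ) (w : ℕ → Ω → Fin n → ℝ) (v : ℕ → Ω → Fin m → ℝ)
    (k : ℕ) (ω : Ω) : Fin m → ℝ :=
  C *ᵥ state A x0 w k ω + v k ω

/-- A `p`-sparse attack: the injected biases `a(k)` (arbitrary, possibly random and depending on
everything else) are supported in one fixed set of `p` sensors. -/
def IsSparseAttack (p : ℕ) (a : ℕ → Ω → Fin m → ℝ) : Prop :=
  ∃ I : Finset (Fin m), I.card = p ∧ ∀ k ω i, a k ω i ≠ 0 → i ∈ I

/-- The system `(A, C_S)`, which uses only the sensors of `S`, is observable: the only initial state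
with identically zero (noise-free) output on `S` is zero. -/
def IsObservable (A : Matrix (Fin n) (Fin n) ℝ) (C : Matrix (Fin m) (Fin n) ℝ)
    (S : Finset (Fin m)) : Prop :=
  ∀ x : Fin n → ℝ, (∀ t : ℕ, ∀ i ∈ S, (C *ᵥ ((A ^ t) *ᵥ x)) i = 0) → x = 0

/-- `s` is the sparse observability index of `(A, C)`: the largest number `s` of sensors such that
the system stays observable after the removal of any `s` sensors. -/
def IsSparseObsIndex (A : Matrix (Fin n) (Fin n) ℝ) (C : Matrix (Fin m) (Fin n) ℝ)
    (s : ℕ) : Prop :=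
  IsGreatest {r : ℕ | r ≤ m ∧ ∀ I : Finset (Fin m), I.card = r → IsObservable A C Iᶜ} s

/-! ### Estimators and security -/

/-- The history `y(0:k)`. -/
def hist (y : ℕ → Fin m → ℝ) (k : ℕ) : Fin (k + 1) → Fin m → ℝ := fun t => y t

/-- The estimator `g` is secure against `p`-sparse attacks, when `z` is the attack-free measurement
process: the differences `d_k = ‖g_k(z(0:k)) - g_k(y(0:k))‖₂`, `y = z + a`, satisfy
`sup_k E[d_k ^ 2] ≤ B < ∞` with a constant `B` that does not depend on the attack `a`. -/
def IsSecure [MeasurableSpace Ω] (μ : Measure Ω) (z : ℕ → Ω → Fin m → ℝ) (p : ℕ)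
    (g : (k : ℕ) → (Fin (k + 1) → Fin m → ℝ) → Fin n → ℂ) : Prop :=
  ∃ B : ℝ≥0, ∀ a : ℕ → Ω → Fin m → ℝ, IsSparseAttack p a →
    ⨆ k : ℕ, ∫⁻ ω, ‖WithLp.toLp 2 (g k (hist (fun t => z t ω) k)
      - g k (hist (fun t => z t ω + a t ω) k))‖ₑ ^ 2 ∂μ ≤ B

/-! ### The Kalman filter -/

/-- The Kalman gain `S C' (C S C' + R)⁻¹` for the prediction covariance `S`. -/
def gain (C : Matrix (Fin m) (Fin n) ℝ) (R : Matrix (Fin m) (Fin m) ℝ)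
    (S : Matrix (Fin n) (Fin n) ℝ) : Matrix (Fin n) (Fin m) ℝ :=
  S * Cᵀ * (C * S * Cᵀ + R)⁻¹

/-- The prediction covariances `P(k | k-1)` of the Kalman filter, with `P(0 | -1) = S0`. -/
def priorCov (A : Matrix (Fin n) (Fin n) ℝ) (C : Matrix (Fin m) (Fin n) ℝ)
    (Q : Matrix (Fin n) (Fin n) ℝ) (R : Matrix (Fin m) (Fin m) ℝ)
    (S0 : Matrix (Fin n) (Fin n) ℝ) : ℕ → Matrix (Fin n) (Fin n) ℝ
  | 0 => S0
  | k + 1 =>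
    A * (priorCov A C Q R S0 k
      - gain C R (priorCov A C Q R S0 k) * C * priorCov A C Q R S0 k) * Aᵀ + Q

/-- The error covariances `P(k) = P(k | k-1) - K(k) C P(k | k-1)` of the Kalman filter. -/
def postCov (A : Matrix (Fin n) (Fin n) ℝ) (C : Matrix (Fin m) (Fin n) ℝ)
    (Q : Matrix (Fin n) (Fin n) ℝ) (R : Matrix (Fin m) (Fin m) ℝ)
    (S0 : Matrix (Fin n) (Fin n) ℝ) (k : ℕ) : Matrix (Fin n) (Fin n) ℝ :=
  priorCov A C Q R S0 k - gain C R (priorCov A C Q R S0 k) * C * priorCov A C Q R S0 k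

/-- `A - K C A` with the steady-state gain `K` belonging to `P₊ = A P A' + Q`. -/
def closedLoop (A : Matrix (Fin n) (Fin n) ℝ) (C : Matrix (Fin m) (Fin n) ℝ)
    (Q : Matrix (Fin n) (Fin n) ℝ) (R : Matrix (Fin m) (Fin m) ℝ)
    (P : Matrix (Fin n) (Fin n) ℝ) : Matrix (Fin n) (Fin n) ℝ :=
  A - gain C R (A * P * Aᵀ + Q) * C * A

/-! ### Local estimates and the canonical form -/

/-- A real matrix, seen as a complex matrix. -/
def cpx {α β : Type*} (M : Matrix α β ℝ) : Matrix α β ℂ := M.map (fun r => (r : ℂ))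

/-- The local estimate of one sensor with measurements `y`:
`ζ(k+1) = Π ζ(k) + 1 y(k+1)`, `Π = diag(ev)`, started at `ζ(0) = s + r y(0)`. -/
def localEst (ev s r : Fin n → ℂ) (y : ℕ → ℝ) : ℕ → Fin n → ℂ
  | 0 => fun j => s j + r j * (y 0 : ℂ)
  | k + 1 => fun j => ev j * localEst ev s r y k j + (y (k + 1) : ℂ)

/-- The matrix `G_i`, whose `j`-th row is `C_i A (A - ev_j I)⁻¹`. -/
def G (A : Matrix (Fin n) (Fin n) ℝ) (C : Matrix (Fin m) (Fin n) ℝ) (ev : Fin n → ℂ)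
    (i : Fin m) : Matrix (Fin n) (Fin n) ℂ :=
  Matrix.of fun j => cpx C i ᵥ* (cpx A * (cpx A - ev j • 1)⁻¹)

/-- `J` is a Jordan canonical form (ones above the diagonal) with exactly one block per eigenvalue:
equal diagonal entries are contiguous, and two neighbouring diagonal entries are linked by a `1`
exactly if they are equal. -/
def IsNonderogatoryJordan (J : Matrix (Fin n) (Fin n) ℂ) : Prop :=
  ∃ d : Fin n → ℂ, (∀ i j k : Fin n, i ≤ j → j ≤ k → d i = d k → d j = d i) ∧
    (∀ i, J i i = d i) ∧
    (∀ i j : Fin n, i ≠ j → J i j = 1 ∧ (i : ℕ) + 1 = j ∧ d i = d j ∨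
      J i j = 0 ∧ ¬ ((i : ℕ) + 1 = j ∧ d i = d j))

/-- The observability matrix with rows `c, c J, …, c J ^ (n-1)`. -/
def obsMatrix (J : Matrix (Fin n) (Fin n) ℂ) (c : Fin n → ℂ) : Matrix (Fin n) (Fin n) ℂ :=
  Matrix.of fun t => c ᵥ* J ^ (t : ℕ)

/-- `S_j`, for the system in coordinates with state matrix `J` and output matrix `D`: the sensors
that can observe state `j`, i.e. for which `O_i e_j ≠ 0`. -/
def observers (J : Matrix (Fin n) (Fin n) ℂ) (D : Matrix (Fin m) (Fin n) ℂ) (j : Fin n) :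
    Set (Fin m) :=
  {i | obsMatrix J (D i) *ᵥ Pi.single j 1 ≠ 0}

open Classical in
/-- The canonical form `H_i = diag(1_{i ∈ S_1}, …, 1_{i ∈ S_n})`. -/
def canon (J : Matrix (Fin n) (Fin n) ℂ) (D : Matrix (Fin m) (Fin n) ℂ) (i : Fin m) :
    Matrix (Fin n) (Fin n) ℂ :=
  Matrix.diagonal fun j => if i ∈ observers J D j then 1 else 0

/-- `m` blocks stacked on top of each other. -/
def stack (B : Fin m → Matrix (Fin n) (Fin n) ℂ) : Matrix (Fin m × Fin n) (Fin n) ℂ :=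
  Matrix.of fun q => B q.1 q.2

/-- `diag(B_1, …, B_m)`. -/
def blockDiag (B : Fin m → Matrix (Fin n) (Fin n) ℂ) :
    Matrix (Fin m × Fin n) (Fin m × Fin n) ℂ :=
  Matrix.of fun q q' => if q.1 = q'.1 then B q.1 q.2 q'.2 else 0

/-- The covariance `Q̃ = L Q L' + R ⊗ 1_{n×n}`, where `L` stacks the matrices `G_i - 1 C_i`. -/
def noiseCov (A : Matrix (Fin n) (Fin n) ℝ) (C : Matrix (Fin m) (Fin n) ℝ)
    (Q : Matrix (Fin n) (Fin n) ℝ) (R : Matrix (Fin m) (Fin m) ℝ) (ev : Fin n → ℂ) :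
    Matrix (Fin m × Fin n) (Fin m × Fin n) ℂ :=
  stack (fun i => G A C ev i - Matrix.of fun _ => cpx C i) * cpx Q *
      (stack (fun i => G A C ev i - Matrix.of fun _ => cpx C i))ᴴ
    + cpx R ⊗ₖ Matrix.of fun (_ _ : Fin n) => (1 : ℂ)

/-- The Lyapunov equation `W = Π̃ W Π̃' + Q̃` with `Π̃ = diag(Π, …, Π)`. -/
def IsLyapunovSol (A : Matrix (Fin n) (Fin n) ℝ) (C : Matrix (Fin m) (Fin n) ℝ)
    (Q : Matrix (Fin n) (Fin n) ℝ) (R : Matrix (Fin m) (Fin m) ℝ) (ev : Fin n → ℂ)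
    (W : Matrix (Fin m × Fin n) (Fin m × Fin n) ℂ) : Prop :=
  W = blockDiag (fun _ => Matrix.diagonal ev) * W * (blockDiag fun _ => Matrix.diagonal ev)ᴴ
    + noiseCov A C Q R ev

/-- `U` is an admissible choice of the transformations: each `U i` is invertible and brings `G_i`,
written in the coordinates given by the basis change `T`, to its canonical form. -/
def IsTransform (A : Matrix (Fin n) (Fin n) ℝ) (C : Matrix (Fin m) (Fin n) ℝ) (ev : Fin n → ℂ)
    (T J : Matrix (Fin n) (Fin n) ℂ) (U : Fin m → Matrix (Fin n) (Fin n) ℂ) : Prop :=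
  ∀ i, IsUnit (U i).det ∧ U i * (G A C ev i * T) = canon J (cpx C * T) i

/-! ### The convex program -/

/-- The cost `½ mu' M⁻¹ mu + γ ‖nu‖₁`. -/
def progCost (γ : ℝ) (M : Matrix (Fin m × Fin n) (Fin m × Fin n) ℂ)
    (mu nu : Fin m × Fin n → ℂ) : ℝ :=
  1 / 2 * (star mu ⬝ᵥ (M⁻¹ *ᵥ mu)).re + γ * ∑ q, ‖nu q‖

/-- `(x, mu, nu)` minimizes `½ mu' M⁻¹ mu + γ ‖nu‖₁` subject to `Y = H x + mu + nu`, where `x`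
ranges over the real subspace `X` of `ℂ^n`. -/
def IsProgSol (X : Submodule ℝ (Fin n → ℂ)) (γ : ℝ)
    (M : Matrix (Fin m × Fin n) (Fin m × Fin n) ℂ) (H : Matrix (Fin m × Fin n) (Fin n) ℂ)
    (Y : Fin m × Fin n → ℂ) (x : Fin n → ℂ) (mu nu : Fin m × Fin n → ℂ) : Prop :=
  x ∈ X ∧ Y = H *ᵥ x + mu + nu ∧
    ∀ x' ∈ X, ∀ mu' nu' : Fin m × Fin n → ℂ, Y = H *ᵥ x' + mu' + nu' →
      progCost γ M mu nu ≤ progCost γ M mu' nu'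

/-- The data `𝒴(k)`, which stacks the vectors `U_i ζ_i(k)`. -/
def progData (ev : Fin n → ℂ) (s r : Fin m → Fin n → ℂ)
    (U : Fin m → Matrix (Fin n) (Fin n) ℂ) (y : ℕ → Fin m → ℝ) (k : ℕ) :
    Fin m × Fin n → ℂ :=
  fun q => (U q.1 *ᵥ localEst ev (s q.1) (r q.1) (fun t => y t q.1) k) q.2

end SecureEst

end

namespace SecureEst

/-! The security bound is a deterministic inequality, valid for every sample: the estimate stays
within a multiple of an attack-independent error `phi`, plus a constant, of the state `x(k)`,
whether or not the data are attacked. The triangle inequality through `x(k)` then compares the two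
estimates. The state itself may be unbounded in L²; only the errors must be bounded.

Stability. The limit `P` satisfies a Riccati equation. In Joseph form this is a Lyapunov equation,
which excludes `‖ev j‖ ≥ 1` because `ev j` is not an eigenvalue of `A` (`norm_eigenvalue_lt_one`).
Without attack, `ζ_i` tracks `G_i x` with an error obeying a stable recursion driven by Gaussian
noise, so the error is L²-bounded (`localErr_succ`, `isL2Bounded_localErr`).

Canonical form. The kernel of `G_i T` is the unobservable subspace of `(J, C_i T)`. It is
`J`-invariant, hence spanned by basis vectors (`IsNonderogatoryJordan.single_mem`), so it equals the
kernel of the 0-1 diagonal matrix `H_i`; equal kernels yield the transformation `P_i`. Sparse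
observability means that each coordinate is seen by more than `2p` sensors
(`IsSparseObsIndex.lt_card_observers`), so `p` sensors never carry half of the ℓ¹ norm of `H_1 u, …,
H_m u`.

Robustness. `W` and `M` are positive definite, which gives existence of minimizers and a bound on
the optimal `mu` independent of the data (`exists_norm_le_of_isProgSol`). Comparing a minimizer with
the true state at the same `mu` leaves an ℓ¹ comparison, and the majority property finishes as in
compressed sensing (`IsProgSol.sum_norm_sub_le`). -/

/-- The unobservable subspace of `(M, c)`. -/
def unobservable {n : ℕ} (M : Matrix (Fin n) (Fin n) ℂ) (c : Fin n → ℂ) :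
    Submodule ℂ (Fin n → ℂ) where
  carrier := {x | ∀ t : ℕ, c ⬝ᵥ ((M ^ t) *ᵥ x) = 0}
  add_mem' := fun {a b} ha hb t => by
    rw [Matrix.mulVec_add, dotProduct_add, ha t, hb t, add_zero]
  zero_mem' := fun t => by simp
  smul_mem' := fun r x hx t => by
    rw [Matrix.mulVec_smul, dotProduct_smul, hx t, smul_zero]

/-! ### Unobservable subspaces and resolvents. -/

section Unobservable

variable {n : ℕ} {M : Matrix (Fin n) (Fin n) ℂ} {c : Fin n → ℂ} {x : Fin n → ℂ}

theorem mulVec_mem_unobservable (hx : x ∈ unobservable M c) : M *ᵥ x ∈ unobservable M c := by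
  intro t
  rw [Matrix.mulVec_mulVec, ← pow_succ]
  exact hx (t + 1)

open Polynomial in
theorem aeval_mulVec_mem_unobservable (hx : x ∈ unobservable M c) (q : ℂ[X]) :
    aeval M q *ᵥ x ∈ unobservable M c := by
  induction q using Polynomial.induction_on' with
  | add p q hp hq =>
    rw [map_add, Matrix.add_mulVec]
    exact Submodule.add_mem _ hp hq
  | monomial t a =>
    rw [aeval_monomial, Algebra.algebraMap_eq_smul_one, smul_mul_assoc, one_mul,
      Matrix.smul_mulVec]
    refine Submodule.smul_mem _ _ ?_
    induction t with
    | zero => simpa using hx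
    | succ t ih =>
      rw [pow_succ', ← Matrix.mulVec_mulVec]
      exact mulVec_mem_unobservable ih

open Polynomial in
/-- By the Cayley-Hamilton theorem a polynomial in `M` may be tested in degrees below `n`. -/
theorem dotProduct_aeval_mulVec_eq_zero
    (h : ∀ q : ℂ[X], q.degree < n → c ⬝ᵥ (aeval M q *ᵥ x) = 0) (q : ℂ[X]) :
    c ⬝ᵥ (aeval M q *ᵥ x) = 0 := by
  rw [Matrix.aeval_eq_aeval_mod_charpoly]
  apply h
  have := degree_modByMonic_lt q M.charpoly_monic
  rwa [Matrix.charpoly_degree_eq_dim, Fintype.card_fin] at this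

open Polynomial in
theorem mem_unobservable_of_lt (h : ∀ t < n, c ⬝ᵥ ((M ^ t) *ᵥ x) = 0) :
    x ∈ unobservable M c := by
  intro t
  have := dotProduct_aeval_mulVec_eq_zero (M := M) (c := c) (x := x) ?_ (X ^ t)
  · simpa using this
  intro q hq
  by_cases h0 : q = 0
  · simp [h0]
  rw [aeval_eq_sum_range, Matrix.sum_mulVec, dotProduct_sum]
  refine Finset.sum_eq_zero fun i hi => ?_
  rw [Matrix.smul_mulVec, dotProduct_smul, h i, smul_zero]
  have := (natDegree_lt_iff_degree_lt h0).2 hq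
  rw [Finset.mem_range] at hi
  omega

/-- An injective endomorphism of the finite-dimensional `N` is onto, so the inverse also preserves
`N`. -/
theorem inv_mulVec_mem {N : Submodule ℂ (Fin n → ℂ)} {B : Matrix (Fin n) (Fin n) ℂ}
    (hB : IsUnit B.det) (hN : ∀ y ∈ N, B *ᵥ y ∈ N) (hx : x ∈ N) : B⁻¹ *ᵥ x ∈ N := by
  have hinj : Function.Injective (B.mulVecLin.restrict hN) := by
    intro y z hyz
    have h1 : B *ᵥ (y : Fin n → ℂ) = B *ᵥ (z : Fin n → ℂ) := congrArg Subtype.val hyz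
    exact Subtype.ext (Matrix.mulVec_injective_of_isUnit ((Matrix.isUnit_iff_isUnit_det B).2 hB) h1)
  obtain ⟨y, hy⟩ := LinearMap.injective_iff_surjective.1 hinj ⟨x, hx⟩
  have h1 : B *ᵥ (y : Fin n → ℂ) = x := congrArg Subtype.val hy
  rw [← h1, Matrix.mulVec_mulVec, Matrix.nonsing_inv_mul _ hB, Matrix.one_mulVec]
  exact y.2

open Polynomial in
theorem aeval_X_sub_C (a : ℂ) : aeval M (X - C a) = M - a • 1 := by
  rw [map_sub, aeval_X, aeval_C, Algebra.algebraMap_eq_smul_one]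

open Polynomial in
/-- The unobservable subspace in terms of the resolvents at `n` distinct points outside the
spectrum. -/
theorem mem_unobservable_iff_resolvent (hM : IsUnit M.det) {ev : Fin n → ℂ}
    (hinj : Function.Injective ev) (hev : ∀ j, IsUnit (M - ev j • 1).det) :
    x ∈ unobservable M c ↔ ∀ j, c ⬝ᵥ ((M * (M - ev j • 1)⁻¹) *ᵥ x) = 0 := by
  constructor
  · intro hx j
    have h1 : (M - ev j • 1)⁻¹ *ᵥ x ∈ unobservable M c := by
      refine inv_mulVec_mem (hev j) (fun y hy => ?_) hx
      rw [← aeval_X_sub_C]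
      exact aeval_mulVec_mem_unobservable hy _
    have h2 := mulVec_mem_unobservable h1 0
    rwa [pow_zero, Matrix.one_mulVec, Matrix.mulVec_mulVec] at h2
  · intro h
    have hunit : ∀ s : Finset (Fin n), IsUnit (aeval M (Lagrange.nodal s ev)) := by
      intro s
      induction s using Finset.induction_on with
      | empty => simp
      | insert a s ha ih =>
        rw [Lagrange.nodal, Finset.prod_insert ha, map_mul, aeval_X_sub_C]
        exact ((Matrix.isUnit_iff_isUnit_det _).2 (hev a)).mul ih
    -- For `x = B y` the hypothesis at `j` says that `c M` annihilates `∏_{l ≠ j} (M - ev l) y`, up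
    -- to a scalar a Lagrange basis polynomial in `M` applied to `y`. These polynomials span all
    -- degrees below `n`, and Cayley-Hamilton covers the rest.
    set B := aeval M (Lagrange.nodal Finset.univ ev) with hBdef
    have hB : IsUnit B := hunit _
    set y := B⁻¹ *ᵥ x with hy
    have hxy : x = B *ᵥ y := by
      rw [hy, Matrix.mulVec_mulVec, Matrix.mul_nonsing_inv _ ((Matrix.isUnit_iff_isUnit_det _).1 hB),
        Matrix.one_mulVec]
    have hbasis : ∀ j, c ⬝ᵥ (M *ᵥ (aeval M (Lagrange.basis Finset.univ ev j) *ᵥ y)) = 0 := by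
      intro j
      have h1 := h j
      rw [hxy, hBdef, Lagrange.nodal_eq_mul_nodal_erase (Finset.mem_univ j), map_mul,
        aeval_X_sub_C, ← Matrix.mulVec_mulVec, ← Matrix.mulVec_mulVec,
        Matrix.mulVec_mulVec _ (M - ev j • 1)⁻¹, Matrix.nonsing_inv_mul _ (hev j),
        Matrix.one_mulVec] at h1
      rw [Lagrange.basis_eq_prod_sub_inv_mul_nodal_div (Finset.mem_univ j),
        ← Lagrange.nodal_erase_eq_nodal_div (Finset.mem_univ j), map_mul, aeval_C,
        Algebra.algebraMap_eq_smul_one, smul_mul_assoc, one_mul, Matrix.smul_mulVec,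
        Matrix.mulVec_smul, dotProduct_smul, h1, smul_zero]
    have hlow : ∀ q : ℂ[X], q.degree < n → (c ᵥ* M) ⬝ᵥ (aeval M q *ᵥ y) = 0 := by
      intro q hq
      rw [← dotProduct_mulVec, Lagrange.eq_interpolate (f := q) (s := Finset.univ) hinj.injOn
        (by simpa using hq), Lagrange.interpolate_apply, map_sum, Matrix.sum_mulVec,
        Matrix.mulVec_sum, dotProduct_sum]
      refine Finset.sum_eq_zero fun j _ => ?_
      rw [map_mul, aeval_C, Algebra.algebraMap_eq_smul_one, smul_mul_assoc, one_mul,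
        Matrix.smul_mulVec, Matrix.mulVec_smul, dotProduct_smul, hbasis, smul_zero]
    have hMy : M *ᵥ y ∈ unobservable M c := by
      intro t
      have h1 := dotProduct_aeval_mulVec_eq_zero hlow (X ^ t)
      rw [map_pow, aeval_X, ← dotProduct_mulVec, Matrix.mulVec_mulVec, ← pow_succ'] at h1
      rwa [Matrix.mulVec_mulVec, ← pow_succ]
    have hyN : y ∈ unobservable M c := by
      have h1 := inv_mulVec_mem hM (fun z hz => mulVec_mem_unobservable hz) hMy
      rwa [Matrix.mulVec_mulVec, Matrix.nonsing_inv_mul _ hM, Matrix.one_mulVec] at h1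
    rw [hxy]
    exact aeval_mulVec_mem_unobservable hyN _

/-- Square matrices with the same kernel differ by an invertible factor on the left. -/
theorem exists_isUnit_mul_eq {B D : Matrix (Fin n) (Fin n) ℂ}
    (h : ∀ x, B *ᵥ x = 0 ↔ D *ᵥ x = 0) : ∃ U : Matrix (Fin n) (Fin n) ℂ,
      IsUnit U.det ∧ U * B = D := by
  have hker : LinearMap.ker B.mulVecLin = LinearMap.ker D.mulVecLin := by
    ext x
    exact h x
  -- Both ranges are the quotient by the common kernel. The resulting isomorphism of subspaces
  -- extends to an automorphism of the whole space.
  let e := B.mulVecLin.quotKerEquivRange.symm ≪≫ₗ Submodule.quotEquivOfEq _ _ hker ≪≫ₗ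
    D.mulVecLin.quotKerEquivRange
  obtain ⟨g, hg⟩ := Submodule.exists_linearEquiv_restrict_eq e
  have hgB : ∀ x, g (B *ᵥ x) = D *ᵥ x := by
    intro x
    have h1 := hg ⟨B.mulVecLin x, LinearMap.mem_range_self _ x⟩
    have h2 : B.mulVecLin.quotKerEquivRange.symm ⟨B.mulVecLin x, LinearMap.mem_range_self _ x⟩
        = Submodule.Quotient.mk x := by
      rw [LinearEquiv.symm_apply_eq]
      rfl
    rw [← Matrix.mulVecLin_apply, ← h1]
    simp only [e, LinearEquiv.trans_apply, h2]
    rfl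
  refine ⟨LinearMap.toMatrix' (g : (Fin n → ℂ) →ₗ[ℂ] (Fin n → ℂ)), ?_, ?_⟩
  · rw [LinearMap.det_toMatrix']
    exact LinearEquiv.isUnit_det' g
  · apply Matrix.toLin'.injective
    ext1 j
    ext1
    simp only [LinearMap.comp_apply, Matrix.toLin'_mul, Matrix.toLin'_toMatrix',
      Matrix.toLin'_apply]
    rw [LinearEquiv.coe_coe, hgB]

end Unobservable

/-! ### Invariant subspaces of a nonderogatory Jordan form. -/

section Jordan

variable {n : ℕ} {J : Matrix (Fin n) (Fin n) ℂ}

/-- In nonderogatory Jordan form an invariant subspace is spanned by the basis vectors that it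
contains. -/
theorem IsNonderogatoryJordan.single_mem (hJ : IsNonderogatoryJordan J)
    {N : Submodule ℂ (Fin n → ℂ)} (hN : ∀ y ∈ N, J *ᵥ y ∈ N) {x : Fin n → ℂ} (hx : x ∈ N)
    {j : Fin n} (hj : x j ≠ 0) : Pi.single j 1 ∈ N := by
  classical
  obtain ⟨d, hcont, hdiag, hoff⟩ := hJ
  have hlast : ∀ (y : Fin n → ℂ) (i : Fin n), (∀ l, i < l → d i = d l → y l = 0) →
      (J *ᵥ y) i = d i * y i := by
    intro y i h
    rw [Matrix.mulVec, dotProduct, Finset.sum_eq_single i, hdiag]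
    · intro l _ hl
      rcases hoff i l hl.symm with ⟨_, h2, h3⟩ | ⟨h1, _⟩
      · rw [h l (Fin.lt_def.2 (by omega)) h3, mul_zero]
      · rw [h1, zero_mul]
    · simp
  have hnext : ∀ (y : Fin n → ℂ) (i k : Fin n), (i : ℕ) + 1 = k → d i = d k →
      (J *ᵥ y) i = d i * y i + y k := by
    intro y i k hik hd
    have hne : i ≠ k := fun h => by rw [h] at hik; omega
    rw [Matrix.mulVec, dotProduct, ← Finset.sum_subset (Finset.subset_univ {i, k}),
      Finset.sum_pair hne, hdiag]
    · rcases hoff i k hne with ⟨h1, _⟩ | ⟨_, h2⟩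
      · rw [h1, one_mul]
      · exact absurd ⟨hik, hd⟩ h2
    · intro l _ hl
      simp only [Finset.mem_insert, Finset.mem_singleton, not_or] at hl
      rcases hoff i l (Ne.symm hl.1) with ⟨_, h2, _⟩ | ⟨h1, _⟩
      · exact absurd (Fin.ext (by omega)) hl.2
      · rw [h1, zero_mul]
  -- `D y` collects the indices at or before a nonzero coordinate of `y` in the same block. The
  -- induction on its size shows that all their basis vectors lie in `N`.
  let D : (Fin n → ℂ) → Finset (Fin n) := fun y =>
    Finset.univ.filter fun i => ∃ l, i ≤ l ∧ d i = d l ∧ y l ≠ 0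
  have hD : ∀ y i, i ∈ D y ↔ ∃ l, i ≤ l ∧ d i = d l ∧ y l ≠ 0 := by
    intro y i
    simp [D]
  have htop : ∀ y i, i ∈ D y → ∃ l, i ≤ l ∧ d i = d l ∧ y l ≠ 0 ∧
      ∀ l', l < l' → d l = d l' → y l' = 0 := by
    intro y i hi
    obtain ⟨l, hl, hmax⟩ := Finset.exists_max_image
      (Finset.univ.filter fun l => i ≤ l ∧ d i = d l ∧ y l ≠ 0) id
      (by obtain ⟨l, h⟩ := (hD y i).1 hi; exact ⟨l, by simpa using h⟩)
    simp only [Finset.mem_filter, Finset.mem_univ, true_and] at hl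
    refine ⟨l, hl.1, hl.2.1, hl.2.2, fun l' hl' hd => ?_⟩
    by_contra hne
    have := hmax l' (by simpa using ⟨hl.1.trans hl'.le, hl.2.1.trans hd, hne⟩)
    exact absurd hl' (not_lt.2 this)
  suffices key : ∀ (N' : ℕ) (y : Fin n → ℂ), (D y).card = N' → y ∈ N →
      ∀ i ∈ D y, (Pi.single i 1 : Fin n → ℂ) ∈ N from
    key _ x rfl hx j ((hD _ _).2 ⟨j, le_rfl, rfl, hj⟩)
  intro N'
  induction N' using Nat.strong_induction_on with
  | _ N' ih =>
  intro y hcard hy i₀ hi₀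
  obtain ⟨k, -, -, hyk, hkmax⟩ := htop y i₀ hi₀
  -- `J - d k` shifts the block of `k` up by one and multiplies the last nonzero entry of any other
  -- block by a nonzero number. Hence `D` loses exactly `k`; the vector `e_k` is recovered at the
  -- end by subtracting the others from `y`.
  set y' := J *ᵥ y - d k • y with hy'
  have hy'N : y' ∈ N := N.sub_mem (hN y hy) (N.smul_mem _ hy)
  have hkD : k ∈ D y := (hD _ _).2 ⟨k, le_rfl, rfl, hyk⟩
  have hval : ∀ i, y' i = (J *ᵥ y) i - d k * y i := fun i => rfl
  have hsub : ∀ i ∈ D y', i ∈ D y := by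
    intro i hi
    obtain ⟨l, h1, h2, h3⟩ := (hD _ _).1 hi
    by_contra hcon
    have hz : ∀ l, i ≤ l → d i = d l → y l = 0 := by
      intro l h4 h5
      by_contra h6
      exact hcon ((hD _ _).2 ⟨l, h4, h5, h6⟩)
    apply h3
    rw [hval, hlast y l (fun l' h4 h5 => hz l' (h1.trans h4.le) (h2.trans h5)), hz l h1 h2]
    simp
  have hknot : k ∉ D y' := by
    intro hk
    obtain ⟨l, h1, h2, h3⟩ := (hD _ _).1 hk
    apply h3
    rw [hval, hlast y l (fun l' h4 h5 => hkmax l' (h1.trans_lt h4) (h2.trans h5)), h2]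
    ring
  have hmost : ∀ i ∈ D y, i ≠ k → i ∈ D y' := by
    intro i hi hik
    obtain ⟨l, h1, h2, h3, h4⟩ := htop y i hi
    by_cases hlk : d l = d k
    · have hl : l = k := by
        rcases lt_trichotomy l k with h | h | h
        · exact absurd (h4 k h hlk) hyk
        · exact h
        · exact absurd (hkmax l h hlk.symm) h3
      subst hl
      have hil : (i : ℕ) < l := Fin.lt_def.1 (lt_of_le_of_ne h1 hik)
      let l₁ : Fin n := ⟨(l : ℕ) - 1, by omega⟩
      have hd1 : d l₁ = d i :=
        hcont i l₁ l (Fin.le_def.2 (by simp only [l₁]; omega))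
          (Fin.le_def.2 (by simp only [l₁]; omega)) h2
      refine (hD _ _).2 ⟨l₁, Fin.le_def.2 (by simp only [l₁]; omega), hd1.symm, ?_⟩
      rw [hval, hnext y l₁ l (by simp only [l₁]; omega) (hd1.trans h2), hd1, h2]
      simpa using h3
    · refine (hD _ _).2 ⟨l, h1, h2, ?_⟩
      rw [hval, hlast y l h4, ← sub_mul]
      exact mul_ne_zero (sub_ne_zero.2 hlk) h3
  have hlt : (D y').card < N' := by
    rw [← hcard]
    exact Finset.card_lt_card ⟨hsub, fun h => hknot (h hkD)⟩
  have hrec : ∀ i ∈ D y, i ≠ k → (Pi.single i 1 : Fin n → ℂ) ∈ N := fun i hi hik =>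
    ih _ hlt y' rfl hy'N i (hmost i hi hik)
  by_cases hik : i₀ = k
  · subst hik
    have h1 : y i₀ • (Pi.single i₀ 1 : Fin n → ℂ)
        = y - ∑ i ∈ (D y).erase i₀, y i • (Pi.single i 1 : Fin n → ℂ) := by
      rw [eq_sub_iff_add_eq, add_comm, Finset.sum_erase_add _ _ hkD,
        Finset.sum_subset (Finset.subset_univ (D y))]
      · exact (pi_eq_sum_univ' y).symm
      · intro l _ hl
        have : y l = 0 := by
          by_contra h
          exact hl ((hD _ _).2 ⟨l, le_rfl, rfl, h⟩)
        rw [this, zero_smul]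
    have h2 : y i₀ • (Pi.single i₀ 1 : Fin n → ℂ) ∈ N := by
      rw [h1]
      exact N.sub_mem hy (N.sum_mem fun i hi =>
        N.smul_mem _ (hrec i (Finset.mem_of_mem_erase hi) (Finset.ne_of_mem_erase hi)))
    exact (N.smul_mem_iff hyk).1 h2
  · exact hrec i₀ hi₀ hik

end Jordan

/-! ### Canonical forms, existence of the transformations, and counting observers. -/

section CanonicalForm

variable {m n : ℕ} {A : Matrix (Fin n) (Fin n) ℝ} {C : Matrix (Fin m) (Fin n) ℝ}
  {T J : Matrix (Fin n) (Fin n) ℂ} {ev : Fin n → ℂ}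

/-- The observability matrix stops at the power `n - 1`; Cayley-Hamilton supplies the higher powers.
-/
theorem mem_observers_iff {D : Matrix (Fin m) (Fin n) ℂ} {i : Fin m} {j : Fin n} :
    i ∈ observers J D j ↔ Pi.single j 1 ∉ unobservable J (D i) := by
  rw [observers, Set.mem_ofPred_eq, ne_eq, not_iff_not]
  constructor
  · intro h
    refine mem_unobservable_of_lt fun t ht => ?_
    have := congrFun h ⟨t, ht⟩
    rw [dotProduct_mulVec]
    exact this
  · intro h
    ext t
    have := h t
    rw [dotProduct_mulVec] at this
    exact this

theorem canon_mulVec_apply_of_mem {D : Matrix (Fin m) (Fin n) ℂ} {i : Fin m} {j : Fin n}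
    (h : i ∈ observers J D j) (x : Fin n → ℂ) : (canon J D i *ᵥ x) j = x j := by
  rw [canon, Matrix.mulVec_diagonal, if_pos h, one_mul]

theorem canon_mulVec_apply_of_notMem {D : Matrix (Fin m) (Fin n) ℂ} {i : Fin m} {j : Fin n}
    (h : i ∉ observers J D j) (x : Fin n → ℂ) : (canon J D i *ᵥ x) j = 0 := by
  rw [canon, Matrix.mulVec_diagonal, if_neg h, zero_mul]

/-- The unobservable subspace is `J`-invariant, hence a coordinate subspace, and `canon` selects
exactly the coordinates outside it. -/
theorem canon_mulVec_eq_zero_iff (hJ : IsNonderogatoryJordan J) {D : Matrix (Fin m) (Fin n) ℂ}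
    {i : Fin m} {x : Fin n → ℂ} : canon J D i *ᵥ x = 0 ↔ x ∈ unobservable J (D i) := by
  constructor
  · intro h
    rw [pi_eq_sum_univ' x]
    refine Submodule.sum_mem _ fun j _ => ?_
    by_cases hj : i ∈ observers J D j
    · have := congrFun h j
      rw [canon_mulVec_apply_of_mem hj] at this
      rw [this, Pi.zero_apply, zero_smul]
      exact Submodule.zero_mem _
    · rw [mem_observers_iff, not_not] at hj
      exact Submodule.smul_mem _ _ hj
  · intro h
    ext j
    by_cases hj : i ∈ observers J D j
    · rw [canon_mulVec_apply_of_mem hj, Pi.zero_apply]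
      by_contra hx
      exact mem_observers_iff.1 hj (hJ.single_mem (fun _ => mulVec_mem_unobservable) h hx)
    · rw [canon_mulVec_apply_of_notMem hj, Pi.zero_apply]

theorem pow_mul_eq_mul_pow_of_similar {M : Matrix (Fin n) (Fin n) ℂ} (hT : IsUnit T.det)
    (h : M = T * J * T⁻¹) (t : ℕ) : M ^ t * T = T * J ^ t := by
  have h1 : M * T = T * J := by
    rw [h, Matrix.mul_assoc, Matrix.nonsing_inv_mul _ hT, Matrix.mul_one]
  induction t with
  | zero => simp
  | succ t ih => rw [pow_succ', Matrix.mul_assoc, ih, ← Matrix.mul_assoc, h1, Matrix.mul_assoc,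
      ← pow_succ']

theorem mem_unobservable_of_similar {M : Matrix (Fin n) (Fin n) ℂ} (hT : IsUnit T.det)
    (h : M = T * J * T⁻¹) {c x : Fin n → ℂ} :
    x ∈ unobservable J (c ᵥ* T) ↔ T *ᵥ x ∈ unobservable M c := by
  refine forall_congr' fun t => ?_
  rw [← dotProduct_mulVec, Matrix.mulVec_mulVec, Matrix.mulVec_mulVec,
    pow_mul_eq_mul_pow_of_similar hT h]

theorem isUnit_det_sub_smul_one {M : Matrix (Fin n) (Fin n) ℂ} {a : ℂ} (h : a ∉ spectrum ℂ M) :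
    IsUnit (M - a • 1).det := by
  rw [spectrum.notMem_iff, Algebra.algebraMap_eq_smul_one] at h
  rw [← Matrix.isUnit_iff_isUnit_det, ← neg_sub]
  exact h.neg

theorem isUnit_det_cpx (hA : IsUnit A.det) : IsUnit (cpx A).det := by
  have h : (cpx A).det = ((A.det : ℝ) : ℂ) := (RingHom.map_det Complex.ofRealHom A).symm
  rw [h]
  exact hA.map Complex.ofRealHom

theorem G_mul_mulVec_eq_zero_iff (hA : IsUnit A.det) (hev : Function.Injective ev)
    (hevA : ∀ j, ev j ∉ spectrum ℂ (cpx A)) (hT : IsUnit T.det) (hAJ : cpx A = T * J * T⁻¹)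
    {i : Fin m} {x : Fin n → ℂ} :
    (G A C ev i * T) *ᵥ x = 0 ↔ x ∈ unobservable J ((cpx C * T) i) := by
  have h1 : (cpx C * T) i = cpx C i ᵥ* T := Matrix.mul_apply_eq_vecMul _ _ _
  rw [h1, mem_unobservable_of_similar hT hAJ,
    mem_unobservable_iff_resolvent (isUnit_det_cpx hA) hev
      (fun j => isUnit_det_sub_smul_one (hevA j)), ← Matrix.mulVec_mulVec, funext_iff]
  refine forall_congr' fun j => ?_
  rw [dotProduct_mulVec]
  rfl

theorem exists_isTransform (hA : IsUnit A.det) (hev : Function.Injective ev)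
    (hevA : ∀ j, ev j ∉ spectrum ℂ (cpx A)) (hT : IsUnit T.det) (hJ : IsNonderogatoryJordan J)
    (hAJ : cpx A = T * J * T⁻¹) : ∃ U, IsTransform A C ev T J U := by
  have h : ∀ i, ∃ U : Matrix (Fin n) (Fin n) ℂ,
      IsUnit U.det ∧ U * (G A C ev i * T) = canon J (cpx C * T) i := fun i =>
    exists_isUnit_mul_eq fun x => by
      rw [G_mul_mulVec_eq_zero_iff hA hev hevA hT hAJ, canon_mulVec_eq_zero_iff hJ]
  choose U hU using h
  exact ⟨U, hU⟩

theorem cpx_pow (A : Matrix (Fin n) (Fin n) ℝ) (t : ℕ) : cpx (A ^ t) = cpx A ^ t :=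
  map_pow (Complex.ofRealHom.mapMatrix) A t

theorem cpx_mulVec_re {k l : ℕ} (M : Matrix (Fin k) (Fin l) ℝ) (x : Fin l → ℂ) (i : Fin k) :
    ((cpx M *ᵥ x) i).re = (M *ᵥ fun j => (x j).re) i := by
  simp [Matrix.mulVec, dotProduct, cpx]

theorem cpx_mulVec_im {k l : ℕ} (M : Matrix (Fin k) (Fin l) ℝ) (x : Fin l → ℂ) (i : Fin k) :
    ((cpx M *ᵥ x) i).im = (M *ᵥ fun j => (x j).im) i := by
  simp [Matrix.mulVec, dotProduct, cpx]

theorem cpx_mul {k l r : ℕ} (M : Matrix (Fin k) (Fin l) ℝ) (N : Matrix (Fin l) (Fin r) ℝ) :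
    cpx (M * N) = cpx M * cpx N :=
  Matrix.map_mul (f := Complex.ofRealHom)

/-- Observability over `ℝ` extends to complex initial states. -/
theorem IsObservable.eq_zero_of_complex {S : Finset (Fin m)} (h : IsObservable A C S)
    {x : Fin n → ℂ} (hx : ∀ i ∈ S, x ∈ unobservable (cpx A) (cpx C i)) : x = 0 := by
  have key : ∀ (t : ℕ), ∀ i ∈ S, (cpx (C * A ^ t) *ᵥ x) i = 0 := by
    intro t i hi
    rw [cpx_mul, cpx_pow, ← Matrix.mulVec_mulVec]
    exact hx i hi t
  have hre := h (fun j => (x j).re) fun t i hi => by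
    rw [Matrix.mulVec_mulVec, ← cpx_mulVec_re, key t i hi, Complex.zero_re]
  have him := h (fun j => (x j).im) fun t i hi => by
    rw [Matrix.mulVec_mulVec, ← cpx_mulVec_im, key t i hi, Complex.zero_im]
  ext j
  exact Complex.ext (congrFun hre j) (congrFun him j)

open Classical in
/-- After the removal of any `s` sensors every state remains observable, so more than `s` sensors
observe it. -/
theorem IsSparseObsIndex.lt_card_observers {s : ℕ} (hs : IsSparseObsIndex A C s)
    (hT : IsUnit T.det) (hAJ : cpx A = T * J * T⁻¹) (j : Fin n) :
    s < (Finset.univ.filter fun i => i ∈ observers J (cpx C * T) j).card := by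
  by_contra! hcon
  obtain ⟨hsm, hobs⟩ := hs.1
  -- The index speaks of sets of exactly `s` sensors, so the at most `s` observers of `j` are
  -- enlarged to such a set. Its removal makes `T e_j ≠ 0` unobservable.
  obtain ⟨I, hI, hIcard⟩ := Finset.exists_superset_card_eq hcon (by simpa using hsm)
  have h0 : T *ᵥ Pi.single j 1 = 0 := by
    refine (hobs I hIcard).eq_zero_of_complex fun i hi => ?_
    rw [← mem_unobservable_of_similar hT hAJ]
    by_contra hne
    refine Finset.mem_compl.1 hi (hI ?_)
    rw [Finset.mem_filter, mem_observers_iff]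
    exact ⟨Finset.mem_univ _, by rwa [Matrix.mul_apply_eq_vecMul]⟩
  have h1 : (Pi.single j 1 : Fin n → ℂ) = 0 := by
    apply Matrix.mulVec_injective_of_isUnit ((Matrix.isUnit_iff_isUnit_det T).2 hT)
    rw [h0, Matrix.mulVec_zero]
  have := congrFun h1 j
  simp at this

end CanonicalForm

/-! ### Positivity under limits and complexification. -/

section Positivity

open scoped ComplexOrder

theorem posSemidef_of_tendsto {k : ℕ} {F : ℕ → Matrix (Fin k) (Fin k) ℝ}
    {P : Matrix (Fin k) (Fin k) ℝ} (hF : ∀ t, (F t).PosSemidef) (h : Tendsto F atTop (𝓝 P)) :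
    P.PosSemidef := by
  refine Matrix.PosSemidef.of_dotProduct_mulVec_nonneg ?_ fun x => ?_
  · have h1 : Tendsto (fun t => (F t)ᴴ) atTop (𝓝 Pᴴ) :=
      (Continuous.matrix_conjTranspose continuous_id).continuousAt.tendsto.comp h
    refine tendsto_nhds_unique h1 (h.congr fun t => ((hF t).isHermitian).symm)
  · have hc : Continuous fun M : Matrix (Fin k) (Fin k) ℝ => star x ⬝ᵥ (M *ᵥ x) := by fun_prop
    exact ge_of_tendsto' (hc.continuousAt.tendsto.comp h)
      fun t => (hF t).dotProduct_mulVec_nonneg x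

/-- The form at `x` is the sum of the real forms at the real and imaginary parts; the cross terms
cancel by symmetry. -/
theorem PosSemidef.cpx {k : ℕ} {M : Matrix (Fin k) (Fin k) ℝ} (hM : M.PosSemidef) :
    (cpx M).PosSemidef := by
  refine Matrix.PosSemidef.of_dotProduct_mulVec_nonneg ?_ fun x => ?_
  · ext i j
    have := congrFun (congrFun hM.isHermitian i) j
    simp only [Matrix.conjTranspose_apply, star_trivial] at this
    simp [SecureEst.cpx, this]
  · have h1 := hM.dotProduct_mulVec_nonneg fun j => (x j).re
    have h2 := hM.dotProduct_mulVec_nonneg fun j => (x j).im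
    have hsym : ∀ y z : Fin k → ℝ, y ⬝ᵥ (M *ᵥ z) = z ⬝ᵥ (M *ᵥ y) := by
      intro y z
      have h3 : Mᵀ = M := hM.isHermitian
      rw [dotProduct_comm, ← Matrix.vecMul_transpose, h3, ← dotProduct_mulVec]
    rw [Complex.le_def]
    constructor
    · simp only [dotProduct, Pi.star_apply, Complex.zero_re, Complex.re_sum, Complex.mul_re,
        cpx_mulVec_re, cpx_mulVec_im, RCLike.star_def, Complex.conj_re, Complex.conj_im,
        star_trivial, Finset.sum_sub_distrib, neg_mul, Finset.sum_neg_distrib] at h1 h2 ⊢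
      linarith
    · have h3 := hsym (fun j => (x j).re) (fun j => (x j).im)
      simp only [dotProduct, Pi.star_apply, Complex.zero_im, Complex.im_sum, Complex.mul_im,
        cpx_mulVec_re, cpx_mulVec_im, RCLike.star_def, Complex.conj_re, Complex.conj_im,
        Finset.sum_add_distrib, neg_mul, Finset.sum_neg_distrib] at h3 ⊢
      linarith

theorem PosDef.cpx {k : ℕ} {M : Matrix (Fin k) (Fin k) ℝ} (hM : M.PosDef) :
    (cpx M).PosDef := by
  rw [(PosSemidef.cpx hM.posSemidef).posDef_iff_isUnit, Matrix.isUnit_iff_isUnit_det]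
  exact isUnit_det_cpx ((Matrix.isUnit_iff_isUnit_det M).1 hM.isUnit)

end Positivity

/-! ### The Riccati equation and stability of the closed loop. -/

section Kalman

variable {m n : ℕ} {A : Matrix (Fin n) (Fin n) ℝ} {C : Matrix (Fin m) (Fin n) ℝ}
  {Q S S0 P : Matrix (Fin n) (Fin n) ℝ} {R : Matrix (Fin m) (Fin m) ℝ}

theorem posDef_innovationCov (hR : R.PosDef) (hS : S.PosSemidef) : (C * S * Cᵀ + R).PosDef := by
  rw [add_comm]
  refine hR.add_posSemidef ?_
  have := hS.mul_mul_conjTranspose_same C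
  rwa [Matrix.conjTranspose_eq_transpose_of_trivial] at this

theorem gain_mul_innovationCov (hR : R.PosDef) (hS : S.PosSemidef) :
    gain C R S * (C * S * Cᵀ + R) = S * Cᵀ := by
  rw [gain, Matrix.mul_assoc, Matrix.nonsing_inv_mul, Matrix.mul_one]
  exact (Matrix.isUnit_iff_isUnit_det _).1 (posDef_innovationCov hR hS).isUnit

/-- The Joseph form of the measurement update. -/
theorem sub_gain_mul_eq (hR : R.PosDef) (hS : S.PosSemidef) :
    S - gain C R S * C * S = (1 - gain C R S * C) * S * (1 - gain C R S * C)ᵀ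
      + gain C R S * R * (gain C R S)ᵀ := by
  -- The gain equation, multiplied by the transposed gain, is what cancels the quadratic terms of
  -- the Joseph form.
  have h := congrArg (· * (gain C R S)ᵀ) (gain_mul_innovationCov (C := C) hR hS)
  simp only [Matrix.mul_add, Matrix.add_mul, ← Matrix.mul_assoc] at h
  rw [Matrix.transpose_sub, Matrix.transpose_mul, Matrix.transpose_one]
  simp only [Matrix.mul_sub, Matrix.sub_mul, Matrix.mul_one, Matrix.one_mul, ← Matrix.mul_assoc]
  rw [← h]
  abel

theorem posSemidef_sub_gain_mul (hR : R.PosDef) (hS : S.PosSemidef) :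
    (S - gain C R S * C * S).PosSemidef := by
  rw [sub_gain_mul_eq hR hS]
  have h1 := hS.mul_mul_conjTranspose_same (1 - gain C R S * C)
  have h2 := hR.posSemidef.mul_mul_conjTranspose_same (gain C R S)
  simp only [Matrix.conjTranspose_eq_transpose_of_trivial] at h1 h2
  exact h1.add h2

theorem posSemidef_predict (hQ : Q.PosSemidef) (hS : S.PosSemidef) :
    (A * S * Aᵀ + Q).PosSemidef := by
  have h1 := hS.mul_mul_conjTranspose_same A
  rw [Matrix.conjTranspose_eq_transpose_of_trivial] at h1
  exact h1.add hQ

theorem posSemidef_priorCov (hQ : Q.PosSemidef) (hS0 : S0.PosSemidef) (hR : R.PosDef) (k : ℕ) :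
    (priorCov A C Q R S0 k).PosSemidef := by
  induction k with
  | zero => exact hS0
  | succ k ih => exact posSemidef_predict hQ (posSemidef_sub_gain_mul hR ih)

theorem posSemidef_postCov (hQ : Q.PosSemidef) (hS0 : S0.PosSemidef) (hR : R.PosDef) (k : ℕ) :
    (postCov A C Q R S0 k).PosSemidef :=
  posSemidef_sub_gain_mul hR (posSemidef_priorCov hQ hS0 hR k)

theorem continuousAt_mul_of_continuousAt {E : Type*} [TopologicalSpace E] {a b c : ℕ}
    {F : E → Matrix (Fin a) (Fin b) ℝ} {F' : E → Matrix (Fin b) (Fin c) ℝ} {x : E}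
    (hF : ContinuousAt F x) (hF' : ContinuousAt F' x) : ContinuousAt (fun y => F y * F' y) x :=
  ContinuousAt.comp₂ (f := fun q : Matrix (Fin a) (Fin b) ℝ × Matrix (Fin b) (Fin c) ℝ =>
    q.1 * q.2) (by fun_prop) hF hF'

theorem continuousAt_gain (hR : R.PosDef) (hS : S.PosSemidef) : ContinuousAt (gain C R) S := by
  have h1 : ContinuousAt (fun S : Matrix (Fin n) (Fin n) ℝ => (C * S * Cᵀ + R)⁻¹) S := by
    refine ContinuousAt.comp (g := Inv.inv) (f := fun S => C * S * Cᵀ + R)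
      (continuousAt_matrix_inv _ ?_) (by fun_prop)
    have hu := (Matrix.isUnit_iff_isUnit_det _).1 (posDef_innovationCov (C := C) hR hS).isUnit
    rw [Ring.inverse_eq_inv']
    exact continuousAt_inv₀ hu.ne_zero
  have h2 : ContinuousAt (fun S : Matrix (Fin n) (Fin n) ℝ => S * Cᵀ) S := by fun_prop
  exact continuousAt_mul_of_continuousAt h2 h1

/-- The limit of the error covariances solves the algebraic Riccati equation. -/
theorem riccati_of_tendsto (hQ : Q.PosSemidef) (hS0 : S0.PosSemidef) (hR : R.PosDef)
    (hP : Tendsto (postCov A C Q R S0) atTop (𝓝 P)) :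
    P.PosSemidef ∧
      P = (A * P * Aᵀ + Q) - gain C R (A * P * Aᵀ + Q) * C * (A * P * Aᵀ + Q) := by
  have hPpos := posSemidef_of_tendsto (posSemidef_postCov hQ hS0 hR) hP
  refine ⟨hPpos, ?_⟩
  have hpred : ContinuousAt (fun S => A * S * Aᵀ + Q) P := by fun_prop
  have hg := continuousAt_gain (C := C) hR (posSemidef_predict (A := A) hQ hPpos)
  have hupd : ContinuousAt (fun S => S - gain C R S * C * S) (A * P * Aᵀ + Q) :=
    continuousAt_id.sub (continuousAt_mul_of_continuousAt
      (continuousAt_mul_of_continuousAt hg continuousAt_const) continuousAt_id)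
  have h2 : Tendsto (fun k => priorCov A C Q R S0 (k + 1)) atTop (𝓝 (A * P * Aᵀ + Q)) :=
    hpred.tendsto.comp hP
  exact tendsto_nhds_unique (hP.comp (tendsto_add_atTop_nat 1)) (hupd.tendsto.comp h2)

-- A left eigenvector `r` of `A - K C A` for an eigenvalue of modulus at least one, tested in the
-- Lyapunov equation for `P`, forces `r K R K' r* = 0`. Then `r K = 0` as `R` is definite, so `r A =
-- ev j • r`, which is excluded.
open scoped ComplexOrder in
theorem norm_eigenvalue_lt_one (hQ : Q.PosSemidef) (hS0 : S0.PosSemidef) (hR : R.PosDef)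
    (hP : Tendsto (postCov A C Q R S0) atTop (𝓝 P)) {V : Matrix (Fin n) (Fin n) ℂ}
    {ev : Fin n → ℂ} (hV : IsUnit V.det)
    (hdiag : cpx (closedLoop A C Q R P) = V * Matrix.diagonal ev * V⁻¹)
    (hevA : ∀ j, ev j ∉ spectrum ℂ (cpx A)) (j : Fin n) : ‖ev j‖ < 1 := by
  obtain ⟨hPpos, hric⟩ := riccati_of_tendsto hQ hS0 hR hP
  by_contra! hge
  set K := gain C R (A * P * Aᵀ + Q) with hK
  have hF : closedLoop A C Q R P = A - K * C * A := rfl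
  have hlyap : P = (A - K * C * A) * P * (A - K * C * A)ᵀ
      + (1 - K * C) * Q * (1 - K * C)ᵀ + K * R * Kᵀ := by
    rw [sub_gain_mul_eq hR (posSemidef_predict hQ hPpos), ← hK] at hric
    conv_lhs => rw [hric]
    have h1 : A - K * C * A = (1 - K * C) * A := by rw [Matrix.sub_mul, Matrix.one_mul]
    rw [h1, Matrix.transpose_mul, Matrix.mul_add, Matrix.add_mul]
    simp only [Matrix.mul_assoc]
  set r : Fin n → ℂ := V⁻¹ j with hr
  have hrF : r ᵥ* cpx (A - K * C * A) = ev j • r := by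
    rw [← hF, hdiag, hr, ← Matrix.mul_apply_eq_vecMul, Matrix.mul_assoc V, ← Matrix.mul_assoc,
      Matrix.nonsing_inv_mul _ hV, Matrix.one_mul]
    ext l
    rw [Matrix.diagonal_mul, Pi.smul_apply, smul_eq_mul]
  have hr0 : r ≠ 0 := by
    intro h
    have h1 : (V⁻¹ * V) j j = 0 := by
      rw [Matrix.mul_apply_eq_vecMul, ← hr, h, Matrix.zero_vecMul, Pi.zero_apply]
    rw [Matrix.nonsing_inv_mul _ hV, Matrix.one_apply_eq] at h1
    exact one_ne_zero h1
  have hct : ∀ {a b : ℕ} (B : Matrix (Fin a) (Fin b) ℝ), cpx Bᵀ = (cpx B)ᴴ := by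
    intro a b B
    ext i l
    simp [cpx]
  have hquad : ∀ {l : ℕ} (B : Matrix (Fin n) (Fin l) ℝ) (N : Matrix (Fin l) (Fin l) ℝ),
      r ⬝ᵥ (cpx (B * N * Bᵀ) *ᵥ star r)
        = (r ᵥ* cpx B) ⬝ᵥ (cpx N *ᵥ star (r ᵥ* cpx B)) := by
    intro l B N
    rw [cpx_mul, cpx_mul, hct, Matrix.star_vecMul, ← Matrix.mulVec_mulVec, ← Matrix.mulVec_mulVec,
      dotProduct_mulVec]
  have hnn : ∀ {l : ℕ} {N : Matrix (Fin l) (Fin l) ℝ} (_ : N.PosSemidef) (u : Fin l → ℂ),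
      0 ≤ u ⬝ᵥ (cpx N *ᵥ star u) := by
    intro l N hN u
    have := (PosSemidef.cpx hN).dotProduct_mulVec_nonneg (star u)
    rwa [star_star] at this
  have hadd : ∀ M N : Matrix (Fin n) (Fin n) ℝ, cpx (M + N) = cpx M + cpx N := by
    intro M N
    ext
    simp [cpx]
  have heq := congrArg (fun M => r ⬝ᵥ (cpx M *ᵥ star r)) hlyap
  simp only [hadd, Matrix.add_mulVec, dotProduct_add, hquad, hrF] at heq
  rw [star_smul, Matrix.mulVec_smul, smul_dotProduct, dotProduct_smul, smul_smul, smul_eq_mul,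
    RCLike.star_def, Complex.mul_conj] at heq
  have h1 := (Complex.le_def.1 (hnn hPpos r)).1
  have h2 := (Complex.le_def.1 (hnn hQ (r ᵥ* cpx (1 - K * C)))).1
  have h3 := (Complex.le_def.1 (hnn hR.posSemidef (r ᵥ* cpx K))).1
  have heq' := congrArg Complex.re heq
  rw [Complex.add_re, Complex.add_re, Complex.re_ofReal_mul, Complex.normSq_eq_norm_sq] at heq'
  rw [Complex.zero_re] at h1 h2 h3
  -- `heq'` reads `ρ = ‖ev j‖² ρ + a + b` with `ρ, a, b ≥ 0`, so `‖ev j‖ ≥ 1` leaves `b = 0`.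
  have hzero : (r ᵥ* cpx K ⬝ᵥ (cpx R *ᵥ star (r ᵥ* cpx K))).re = 0 := by
    nlinarith [mul_nonneg (by nlinarith : (0 : ℝ) ≤ ‖ev j‖ ^ 2 - 1) h1]
  have hrK : r ᵥ* cpx K = 0 := by
    by_contra hne
    have := (PosDef.cpx hR).dotProduct_mulVec_pos (x := star (r ᵥ* cpx K)) (by simpa using hne)
    rw [star_star] at this
    exact (Complex.lt_def.1 this).1.ne' hzero
  have hrA : r ᵥ* (cpx A - ev j • 1) = 0 := by
    have hs : cpx (A - K * C * A) = cpx A - cpx K * cpx C * cpx A := by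
      rw [← cpx_mul, ← cpx_mul]
      ext
      simp [cpx]
    rw [hs, Matrix.vecMul_sub, ← Matrix.vecMul_vecMul, ← Matrix.vecMul_vecMul, hrK,
      Matrix.zero_vecMul, Matrix.zero_vecMul, sub_zero] at hrF
    rw [Matrix.vecMul_sub, hrF, Matrix.vecMul_smul, Matrix.vecMul_one, sub_self]
  apply hr0
  apply Matrix.vecMul_injective_of_isUnit
    ((Matrix.isUnit_iff_isUnit_det _).2 (isUnit_det_sub_smul_one (hevA j)))
  simpa using hrA

end Kalman

/-! ### The Lyapunov equation and positive definiteness of its solution. -/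

section Lyapunov

open scoped ComplexOrder

theorem one_sub_mul_star_ne_zero {ι : Type*} {e : ι → ℂ} (he : ∀ q, ‖e q‖ < 1) (q q' : ι) :
    1 - e q * star (e q') ≠ 0 := by
  intro h
  have h1 : ‖e q * star (e q')‖ = 1 := by rw [← sub_eq_zero.1 h, norm_one]
  rw [norm_mul, norm_star] at h1
  nlinarith [he q, he q', norm_nonneg (e q), norm_nonneg (e q')]

section General

variable {ι : Type*} [Fintype ι] [DecidableEq ι] {e : ι → ℂ} {W N : Matrix ι ι ℂ}

theorem lyapunov_diagonal_iff : W = Matrix.diagonal e * W * (Matrix.diagonal e)ᴴ + N ↔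
    ∀ q q', (1 - e q * star (e q')) * W q q' = N q q' := by
  rw [← Matrix.ext_iff]
  refine forall_congr' fun q => forall_congr' fun q' => ?_
  rw [Matrix.add_apply, Matrix.diagonal_conjTranspose, Matrix.mul_diagonal, Matrix.diagonal_mul,
    Pi.star_apply, sub_mul, one_mul, sub_eq_iff_eq_add, add_comm (N q q'), mul_right_comm]

theorem existsUnique_lyapunov_diagonal (he : ∀ q, ‖e q‖ < 1) :
    ∃! W, W = Matrix.diagonal e * W * (Matrix.diagonal e)ᴴ + N := by
  refine ⟨Matrix.of fun q q' => (1 - e q * star (e q'))⁻¹ * N q q', ?_, fun W hW => ?_⟩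
  · refine lyapunov_diagonal_iff.2 fun q q' => ?_
    rw [Matrix.of_apply, mul_inv_cancel_left₀ (one_sub_mul_star_ne_zero he q q')]
  · ext q q'
    rw [Matrix.of_apply, ← lyapunov_diagonal_iff.1 hW q q',
      inv_mul_cancel_left₀ (one_sub_mul_star_ne_zero he q q')]

/-- The solution of a stable Lyapunov equation is positive definite if the pair of the state
matrix and the right hand side is controllable. -/
theorem posDef_of_lyapunov_diagonal (he : ∀ q, ‖e q‖ < 1) (hN : N.PosSemidef)
    (hW : W = Matrix.diagonal e * W * (Matrix.diagonal e)ᴴ + N)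
    (hctrl : ∀ x : ι → ℂ, (∀ k : ℕ, N *ᵥ (fun q => star (e q) ^ k * x q) = 0) → x = 0) :
    W.PosDef := by
  have hherm : W.IsHermitian := by
    ext q q'
    apply mul_left_cancel₀ (one_sub_mul_star_ne_zero he q q')
    rw [lyapunov_diagonal_iff.1 hW q q', Matrix.conjTranspose_apply, ← hN.isHermitian.apply,
      ← lyapunov_diagonal_iff.1 hW q' q, star_mul', star_sub, star_one, star_mul', star_star,
      mul_comm (star (e q'))]
  let f : (ι → ℂ) → ℂ := fun x => star x ⬝ᵥ (W *ᵥ x)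
  have hstep : ∀ x : ι → ℂ, f x = f (fun q => star (e q) * x q) + star x ⬝ᵥ (N *ᵥ x) := by
    intro x
    have h1 : (fun q => star (e q) * x q) = (Matrix.diagonal e)ᴴ *ᵥ x := by
      ext q
      rw [Matrix.diagonal_conjTranspose, Matrix.mulVec_diagonal, Pi.star_apply]
    simp only [f]
    conv_lhs => rw [hW]
    rw [Matrix.add_mulVec, dotProduct_add, h1, Matrix.star_mulVec, Matrix.conjTranspose_conjTranspose,
      ← Matrix.mulVec_mulVec, ← Matrix.mulVec_mulVec, ← dotProduct_mulVec]
  -- Along the orbit of the adjoint dynamics the form of `W` decreases to `0`, each drop being a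
  -- value of the form of `N`. So it is nonnegative, and if it vanishes at `x` all drops vanish and
  -- controllability applies.
  let it : (ι → ℂ) → ℕ → ι → ℂ := fun x k q => star (e q) ^ k * x q
  have hit : ∀ x k, f (it x k) = f (it x (k + 1)) + star (it x k) ⬝ᵥ (N *ᵥ it x k) := by
    intro x k
    rw [hstep]
    congr 2
    ext q
    simp only [it, pow_succ']
    ring
  have hit0 : ∀ x, it x 0 = x := fun x => by
    ext q
    simp [it]
  have hanti : ∀ x, Antitone fun k => f (it x k) := fun x =>
    antitone_nat_of_succ_le fun k => by
      rw [hit x k]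
      exact le_add_of_nonneg_right (hN.dotProduct_mulVec_nonneg _)
  have hlim : ∀ x, Tendsto (fun k => f (it x k)) atTop (𝓝 0) := by
    intro x
    have h1 : Tendsto (it x) atTop (𝓝 0) := by
      refine tendsto_pi_nhds.2 fun q => ?_
      have := (tendsto_pow_atTop_nhds_zero_of_norm_lt_one
        (by rw [norm_star]; exact he q : ‖star (e q)‖ < 1)).mul_const (x q)
      rwa [zero_mul] at this
    have hc : Continuous f := by
      simp only [f]
      fun_prop
    have h2 := hc.continuousAt.tendsto.comp h1
    have h3 : f 0 = 0 := by simp [f]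
    rwa [h3] at h2
  have hnonneg : ∀ x k, 0 ≤ f (it x k) := fun x k => (hanti x).le_of_tendsto (hlim x) k
  refine Matrix.PosDef.of_dotProduct_mulVec_pos hherm fun x hx => ?_
  have h0 := hnonneg x 0
  rw [hit0] at h0
  refine lt_of_le_of_ne h0 fun hzero => hx (hctrl x fun k => ?_)
  have hall : ∀ k, f (it x k) = 0 := by
    intro k
    refine le_antisymm ?_ (hnonneg x k)
    have h1 := hanti x (Nat.zero_le k)
    simp only [hit0] at h1
    exact h1.trans hzero.symm.le
  have h1 := hit x k
  rw [hall, hall, zero_add] at h1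
  exact (hN.dotProduct_mulVec_zero_iff _).1 h1.symm

end General

variable {m n : ℕ} {A : Matrix (Fin n) (Fin n) ℝ} {C : Matrix (Fin m) (Fin n) ℝ}
  {Q : Matrix (Fin n) (Fin n) ℝ} {R : Matrix (Fin m) (Fin m) ℝ} {ev : Fin n → ℂ}
  {W : Matrix (Fin m × Fin n) (Fin m × Fin n) ℂ}

theorem blockDiag_diagonal (ev : Fin n → ℂ) :
    blockDiag (fun _ : Fin m => Matrix.diagonal ev) = Matrix.diagonal fun q => ev q.2 := by
  ext ⟨i, j⟩ ⟨i', j'⟩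
  simp only [blockDiag, Matrix.of_apply, Matrix.diagonal_apply, Prod.mk.injEq]
  split_ifs <;> simp_all

theorem existsUnique_isLyapunovSol (hev1 : ∀ j, ‖ev j‖ < 1) :
    ∃! W, IsLyapunovSol A C Q R ev W := by
  simp only [IsLyapunovSol, blockDiag_diagonal]
  exact existsUnique_lyapunov_diagonal fun q => hev1 q.2

theorem ones_posSemidef : (Matrix.of fun (_ _ : Fin n) => (1 : ℂ)).PosSemidef := by
  have h := Matrix.posSemidef_vecMulVec_self_star (fun _ : Fin n => (1 : ℂ))
  convert h using 1
  ext
  simp [Matrix.vecMulVec_apply]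

/-- Controllability comes from the measurement noise alone: since `R` is definite, `R ⊗ 1`
annihilates a vector only if all its block sums vanish. For all powers of the distinct `star (ev j)`
this is a Vandermonde system. -/
theorem posDef_of_isLyapunovSol (hQ : Q.PosSemidef) (hR : R.PosDef) (hev : Function.Injective ev)
    (hev1 : ∀ j, ‖ev j‖ < 1) (hW : IsLyapunovSol A C Q R ev W) : W.PosDef := by
  rw [IsLyapunovSol, blockDiag_diagonal] at hW
  have h1 := (PosSemidef.cpx hQ).mul_mul_conjTranspose_same
    (stack (fun i => G A C ev i - Matrix.of fun _ => cpx C i))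
  have h2 : (cpx R ⊗ₖ Matrix.of fun (_ _ : Fin n) => (1 : ℂ)).PosSemidef :=
    (PosDef.cpx hR).posSemidef.kronecker ones_posSemidef
  refine posDef_of_lyapunov_diagonal (fun q => hev1 q.2) (h1.add h2) hW fun x hx => ?_
  have hsum : ∀ (k : ℕ) (i : Fin m), ∑ j, star (ev j) ^ k * x (i, j) = 0 := by
    intro k
    set y : Fin m × Fin n → ℂ := fun q => star (ev q.2) ^ k * x q with hy
    have h3 := congrArg (star y ⬝ᵥ ·) (hx k)
    simp only [← hy, dotProduct_zero] at h3
    rw [Matrix.add_mulVec, dotProduct_add] at h3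
    have h4 := ((add_eq_zero_iff_of_nonneg (h1.dotProduct_mulVec_nonneg y)
      (h2.dotProduct_mulVec_nonneg y)).1 h3).2
    rw [h2.dotProduct_mulVec_zero_iff] at h4
    -- Reading off a block row below needs an index `j₀` of `Fin n`.
    by_cases hn : n = 0
    · subst hn
      simp
    have j₀ : Fin n := ⟨0, Nat.pos_of_ne_zero hn⟩
    have h5 : cpx R *ᵥ (fun i => ∑ j, y (i, j)) = 0 := by
      ext i
      have h6 := congrFun h4 (i, j₀)
      rw [Matrix.mulVec, dotProduct, Fintype.sum_prod_type] at h6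
      simpa [Matrix.mulVec, dotProduct, Matrix.kroneckerMap_apply, Finset.mul_sum] using h6
    have h6 : (fun i => ∑ j, y (i, j)) = 0 := by
      apply Matrix.mulVec_injective_of_isUnit (PosDef.cpx hR).isUnit
      simpa using h5
    exact congrFun h6
  ext ⟨i, j⟩
  have h7 := Matrix.eq_zero_of_forall_pow_sum_mul_pow_eq_zero (f := fun j => star (ev j))
    (v := fun j => x (i, j)) (star_injective.comp hev) fun k => by
      simpa [mul_comm] using hsum k i
  exact congrFun h7 j

theorem blockDiag_mulVec_apply (U : Fin m → Matrix (Fin n) (Fin n) ℂ) (x : Fin m × Fin n → ℂ)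
    (q : Fin m × Fin n) : (blockDiag U *ᵥ x) q = (U q.1 *ᵥ fun j => x (q.1, j)) q.2 := by
  rw [Matrix.mulVec, dotProduct, Fintype.sum_prod_type, Finset.sum_eq_single q.1]
  · simp [blockDiag, Matrix.mulVec, dotProduct]
  · intro i _ hi
    simp [blockDiag, hi.symm]
  · simp

theorem isUnit_blockDiag {U : Fin m → Matrix (Fin n) (Fin n) ℂ} (hU : ∀ i, IsUnit (U i).det) :
    IsUnit (blockDiag U) := by
  rw [← Matrix.mulVec_injective_iff_isUnit]
  intro x y hxy
  ext ⟨i, j⟩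
  have h := Matrix.mulVec_injective_of_isUnit ((Matrix.isUnit_iff_isUnit_det _).2 (hU i))
    (a₁ := fun j => x (i, j)) (a₂ := fun j => y (i, j)) (by
      ext j
      have := congrFun hxy (i, j)
      rwa [blockDiag_mulVec_apply, blockDiag_mulVec_apply] at this)
  exact congrFun h j

theorem posDef_conj_blockDiag {U : Fin m → Matrix (Fin n) (Fin n) ℂ}
    (hU : ∀ i, IsUnit (U i).det) (hW : W.PosDef) :
    (blockDiag U * W * (blockDiag U)ᴴ).PosDef :=
  hW.mul_mul_conjTranspose_same (Matrix.vecMul_injective_of_isUnit (isUnit_blockDiag hU))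

end Lyapunov

/-! ### Existence of minimizers, and their deterministic error bound. -/

section ConvexProgram

open scoped ComplexOrder

variable {m n : ℕ} {X : Submodule ℝ (Fin n → ℂ)} {γ : ℝ}
  {M : Matrix (Fin m × Fin n) (Fin m × Fin n) ℂ} {H : Matrix (Fin m × Fin n) (Fin n) ℂ}

theorem exists_mul_norm_sq_le_of_posDef {ι : Type*} [Fintype ι] {N : Matrix ι ι ℂ}
    (hN : N.PosDef) : ∃ c : ℝ, 0 < c ∧ ∀ x : ι → ℂ, c * ‖x‖ ^ 2 ≤ (star x ⬝ᵥ (N *ᵥ x)).re := by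
  have hc : Continuous fun x : ι → ℂ => (star x ⬝ᵥ (N *ᵥ x)).re := by fun_prop
  have hnormalize : ∀ x : ι → ℂ, x ≠ 0 → ((‖x‖⁻¹ : ℝ) : ℂ) • x ∈ Metric.sphere (0 : ι → ℂ) 1 := by
    intro x hx
    rw [mem_sphere_zero_iff_norm, norm_smul, Complex.norm_real, norm_inv, norm_norm,
      inv_mul_cancel₀ (norm_ne_zero_iff.2 hx)]
  by_cases hne : (Metric.sphere (0 : ι → ℂ) 1).Nonempty
  · obtain ⟨y, hy, hmin⟩ := (isCompact_sphere (0 : ι → ℂ) 1).exists_isMinOn hne hc.continuousOn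
    have hy0 : y ≠ 0 := by
      rintro rfl
      simp at hy
    refine ⟨_, (Complex.lt_def.1 (hN.dotProduct_mulVec_pos hy0)).1, fun x => ?_⟩
    by_cases hx : x = 0
    · simp [hx]
    have h1 := hmin (hnormalize x hx)
    simp only [Set.mem_ofPred_eq, star_smul, Matrix.mulVec_smul, smul_dotProduct,
      dotProduct_smul, smul_eq_mul, RCLike.star_def, Complex.conj_ofReal] at h1
    rw [← mul_assoc, ← Complex.ofReal_mul, Complex.re_ofReal_mul] at h1
    have hpos : 0 < ‖x‖ := norm_pos_iff.2 hx
    calc _ ≤ (‖x‖⁻¹ * ‖x‖⁻¹ * (star x ⬝ᵥ (N *ᵥ x)).re) * ‖x‖ ^ 2 := by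
          gcongr
      _ = _ := by field_simp
  · refine ⟨1, one_pos, fun x => ?_⟩
    have : x = 0 := by
      by_contra hx
      exact hne ⟨_, hnormalize x hx⟩
    simp [this]

theorem continuous_progCost :
    Continuous fun q : (Fin m × Fin n → ℂ) × (Fin m × Fin n → ℂ) => progCost γ M q.1 q.2 := by
  unfold progCost
  fun_prop

theorem norm_le_sum_norm {ι : Type*} [Fintype ι] (x : ι → ℂ) : ‖x‖ ≤ ∑ q, ‖x q‖ :=
  (pi_norm_le_iff_of_nonneg (Finset.sum_nonneg fun _ _ => norm_nonneg _)).2 fun q =>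
    Finset.single_le_sum (f := fun q => ‖x q‖) (fun _ _ => norm_nonneg _) (Finset.mem_univ q)

theorem sum_norm_le_card_mul_norm {ι : Type*} [Fintype ι] (x : ι → ℂ) :
    ∑ q, ‖x q‖ ≤ Fintype.card ι * ‖x‖ := by
  have := Finset.sum_le_card_nsmul Finset.univ (fun q => ‖x q‖) ‖x‖ fun q _ => norm_le_pi_norm x q
  simpa using this

/-- The cost ignores `x`, so `x` is eliminated: feasibility of `(mu, nu)` is membership in a closed
set, as images of subspaces are closed in finite dimension. On it the sublevel sets are compact,
even if `H` is not injective. -/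
theorem exists_isProgSol (hγ : 0 < γ) (hM : M.PosDef) (Y : Fin m × Fin n → ℂ) :
    ∃ x mu nu, IsProgSol X γ M H Y x mu nu := by
  obtain ⟨c, hc, hbound⟩ := exists_mul_norm_sq_le_of_posDef hM.inv
  let L : (Fin n → ℂ) →ₗ[ℝ] (Fin m × Fin n → ℂ) := H.mulVecLin.restrictScalars ℝ
  let F : Set ((Fin m × Fin n → ℂ) × (Fin m × Fin n → ℂ)) := {q | Y - q.1 - q.2 ∈ X.map L}
  have hF : IsClosed F :=
    (Submodule.closed_of_finiteDimensional (X.map L)).preimage (by fun_prop)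
  let b : ℝ := progCost γ M Y 0
  have hsub : ∀ mu nu, progCost γ M mu nu ≤ b →
      ‖mu‖ ^ 2 ≤ 2 * b / c ∧ ‖nu‖ ≤ b / γ := by
    intro mu nu h
    have h1 := hbound mu
    have h2 := norm_le_sum_norm nu
    have h3 : 0 ≤ c * ‖mu‖ ^ 2 := by positivity
    have h4 : γ * ‖nu‖ ≤ γ * ∑ q, ‖nu q‖ := by gcongr
    have h5 : 0 ≤ γ * ‖nu‖ := by positivity
    unfold progCost at h
    rw [le_div_iff₀ hc, le_div_iff₀ hγ]
    constructor <;> nlinarith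
  -- The bound on `‖mu‖ ^ 2` becomes one on `‖mu‖` by `t ≤ t ^ 2 + 1`.
  let r : ℝ := max (2 * b / c + 1) (b / γ)
  have hr : ∀ q : (Fin m × Fin n → ℂ) × (Fin m × Fin n → ℂ), progCost γ M q.1 q.2 ≤ b →
      q ∈ Metric.closedBall 0 r := by
    intro q hq
    obtain ⟨h1, h2⟩ := hsub q.1 q.2 hq
    rw [mem_closedBall_zero_iff, Prod.norm_def]
    refine max_le_max ?_ h2
    nlinarith [sq_nonneg (‖q.1‖ - 1 / 2)]
  have hYF : (Y, 0) ∈ F ∩ Metric.closedBall 0 r :=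
    ⟨⟨0, X.zero_mem, by simp⟩, hr (Y, 0) le_rfl⟩
  obtain ⟨q, hq, hmin⟩ := ((isCompact_closedBall _ r).inter_left hF).exists_isMinOn ⟨_, hYF⟩
    (continuous_progCost (γ := γ) (M := M)).continuousOn
  obtain ⟨x, hx, hxq⟩ := hq.1
  refine ⟨x, q.1, q.2, hx, ?_, fun x' hx' mu' nu' h' => ?_⟩
  · have : H *ᵥ x = Y - q.1 - q.2 := hxq
    rw [this]
    abel
  · by_cases hle : progCost γ M mu' nu' ≤ b
    · refine hmin (a := (mu', nu')) ⟨⟨x', hx', ?_⟩, hr (mu', nu') hle⟩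
      show H *ᵥ x' = Y - mu' - nu'
      rw [h']
      abel
    · exact (hmin hYF).trans (not_le.1 hle).le

/-- In an optimal solution the quadratic part is bounded independently of the data. -/
theorem IsProgSol.quadratic_le (hγ : 0 < γ) {Y : Fin m × Fin n → ℂ} {x : Fin n → ℂ}
    {mu nu : Fin m × Fin n → ℂ} (h : IsProgSol X γ M H Y x mu nu) :
    (star mu ⬝ᵥ (M⁻¹ *ᵥ mu)).re ≤ γ * ∑ q, ‖mu q‖ := by
  obtain ⟨hx, hY, hmin⟩ := h
  set b := (star mu ⬝ᵥ (M⁻¹ *ᵥ mu)).re with hb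
  -- Moving the fraction `t` of `mu` into `nu` keeps feasibility. Optimality, divided by `t`, gives
  -- the claim as `t → 0`.
  have key : ∀ t : ℝ, 0 < t → t < 1 → (1 - t / 2) * b ≤ γ * ∑ q, ‖mu q‖ := by
    intro t ht ht1
    have h1 := hmin x hx (((1 - t : ℝ) : ℂ) • mu) (nu + ((t : ℝ) : ℂ) • mu) (by
      rw [hY, Complex.ofReal_sub, sub_smul, Complex.ofReal_one, one_smul]
      abel)
    unfold progCost at h1
    rw [star_smul, Matrix.mulVec_smul, smul_dotProduct, dotProduct_smul, smul_smul, smul_eq_mul,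
      RCLike.star_def, Complex.conj_ofReal, ← Complex.ofReal_mul, Complex.re_ofReal_mul, ← hb] at h1
    have h2 : ∑ q, ‖(nu + ((t : ℝ) : ℂ) • mu) q‖ ≤ ∑ q, ‖nu q‖ + t * ∑ q, ‖mu q‖ := by
      rw [Finset.mul_sum, ← Finset.sum_add_distrib]
      refine Finset.sum_le_sum fun q _ => (norm_add_le _ _).trans_eq ?_
      rw [Pi.smul_apply, norm_smul, Complex.norm_real, Real.norm_of_nonneg ht.le]
    have h3 : γ * ∑ q, ‖(nu + ((t : ℝ) : ℂ) • mu) q‖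
        ≤ γ * ∑ q, ‖nu q‖ + t * (γ * ∑ q, ‖mu q‖) := by
      calc _ ≤ γ * (∑ q, ‖nu q‖ + t * ∑ q, ‖mu q‖) := by gcongr
        _ = _ := by ring
    have h4 : t * ((1 - t / 2) * b) ≤ t * (γ * ∑ q, ‖mu q‖) := by nlinarith
    exact le_of_mul_le_mul_left h4 ht
  have hlim : Tendsto (fun t : ℝ => (1 - t / 2) * b) (𝓝[>] 0) (𝓝 b) := by
    have : Continuous fun t : ℝ => (1 - t / 2) * b := by fun_prop
    simpa using (this.tendsto 0).mono_left nhdsWithin_le_nhds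
  refine le_of_tendsto hlim ?_
  filter_upwards [Ioo_mem_nhdsGT (zero_lt_one' ℝ)] with t ht using key t ht.1 ht.2

/-- A definite quadratic form of `mu` is at most linear in `‖mu‖`, which bounds `mu`. -/
theorem exists_norm_le_of_isProgSol (hγ : 0 < γ) (hM : M.PosDef) :
    ∃ b : ℝ, 0 ≤ b ∧ ∀ Y x mu nu, IsProgSol X γ M H Y x mu nu → ∑ q, ‖mu q‖ ≤ b := by
  obtain ⟨c, hc, hbound⟩ := exists_mul_norm_sq_le_of_posDef hM.inv
  set N : ℝ := (Fintype.card (Fin m × Fin n) : ℝ) with hN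
  have hN0 : 0 ≤ N := Nat.cast_nonneg _
  refine ⟨N * (γ * N / c), by positivity, fun Y x mu nu h => ?_⟩
  have h1 := (hbound mu).trans (h.quadratic_le hγ)
  have h2 := sum_norm_le_card_mul_norm mu
  refine h2.trans (mul_le_mul_of_nonneg_left ?_ hN0)
  rw [le_div_iff₀ hc]
  have h3 : c * ‖mu‖ ^ 2 ≤ γ * (N * ‖mu‖) := h1.trans (by gcongr)
  rcases (norm_nonneg mu).eq_or_lt with h0 | h0
  · rw [← h0]
    simpa using by positivity
  · nlinarith

theorem stack_mul_mulVec_apply (B : Fin m → Matrix (Fin n) (Fin n) ℂ)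
    (T : Matrix (Fin n) (Fin n) ℂ) (x : Fin n → ℂ) (q : Fin m × Fin n) :
    ((stack B * T) *ᵥ x) q = (B q.1 *ᵥ (T *ᵥ x)) q.2 := by
  rw [← Matrix.mulVec_mulVec]
  rfl

open Classical in
/-- If more than `2 p` sensors observe every state, then every set of `p` sensors carries less than
half of the `ℓ¹` norm of the canonical outputs. -/
theorem sum_norm_le_signed_sum {J : Matrix (Fin n) (Fin n) ℂ} {D : Matrix (Fin m) (Fin n) ℂ}
    {p : ℕ} (hcard : ∀ j, 2 * p < (Finset.univ.filter fun i => i ∈ observers J D j).card)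
    {I : Finset (Fin m)} (hI : I.card ≤ p) (u : Fin n → ℂ) :
    ∑ j, ‖u j‖ ≤ ∑ q : Fin m × Fin n,
      (if q.1 ∈ I then -1 else 1) * ‖(canon J D q.1 *ᵥ u) q.2‖ := by
  rw [Fintype.sum_prod_type_right]
  refine Finset.sum_le_sum fun j _ => ?_
  -- For fixed `j` the signed sum is (observers minus twice the observers in `I`) times `‖u j‖`, and
  -- this factor is at least `1`.
  have h1 : ∀ i, (if i ∈ I then (-1 : ℝ) else 1) * ‖(canon J D i *ᵥ u) j‖
      = (((if i ∈ observers J D j then 1 else 0 : ℕ) : ℝ)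
        - 2 * ((if i ∈ observers J D j ∧ i ∈ I then 1 else 0 : ℕ) : ℝ)) * ‖u j‖ := by
    intro i
    by_cases ho : i ∈ observers J D j
    · rw [canon_mulVec_apply_of_mem ho]
      by_cases hi : i ∈ I <;> simp [ho, hi]
      norm_num
    · rw [canon_mulVec_apply_of_notMem ho]
      simp [ho]
  simp only [h1]
  rw [← Finset.sum_mul, Finset.sum_sub_distrib, ← Finset.mul_sum, ← Nat.cast_sum, ← Nat.cast_sum,
    ← Finset.card_filter, ← Finset.card_filter]
  have h2 : (Finset.univ.filter fun i => i ∈ observers J D j ∧ i ∈ I).card ≤ p :=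
    (Finset.card_le_card fun i hi => (Finset.mem_filter.1 hi).2.2).trans hI
  have h3 : (2 * (p : ℝ)) + 1 ≤ ((Finset.univ.filter fun i => i ∈ observers J D j).card : ℝ) := by
    exact_mod_cast hcard j
  have h4 : ((Finset.univ.filter fun i => i ∈ observers J D j ∧ i ∈ I).card : ℝ) ≤ p := by
    exact_mod_cast h2
  nlinarith [norm_nonneg (u j)]

open Classical in
/-- The minimizers recover the state up to the noise, whatever the corrupted sensors report. -/
theorem IsProgSol.sum_norm_sub_le {J T : Matrix (Fin n) (Fin n) ℂ} {D : Matrix (Fin m) (Fin n) ℂ}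
    (hγ : 0 < γ) {p : ℕ}
    (hcard : ∀ j, 2 * p < (Finset.univ.filter fun i => i ∈ observers J D j).card)
    {I : Finset (Fin m)} (hI : I.card ≤ p) {x y : Fin n → ℂ} (hx : x ∈ X)
    {phi eta mu nu : Fin m × Fin n → ℂ} (heta : ∀ q, q.1 ∉ I → eta q = 0)
    (h : IsProgSol X γ M (stack (canon J D) * T⁻¹)
      ((stack (canon J D) * T⁻¹) *ᵥ x + phi + eta) y mu nu) :
    ∑ j, ‖(T⁻¹ *ᵥ (y - x)) j‖ ≤ 2 * (∑ q, ‖phi q‖ + ∑ q, ‖mu q‖) := by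
  obtain ⟨hy, hY, hmin⟩ := h
  set H := stack (canon J D) * T⁻¹ with hH
  set u := T⁻¹ *ᵥ (y - x) with hu
  have hnu : nu = phi - mu + eta - H *ᵥ (y - x) := by
    rw [Matrix.mulVec_sub]
    have : nu = H *ᵥ x + phi + eta - H *ᵥ y - mu := by
      rw [hY]
      abel
    rw [this]
    abel
  -- The competitor is the true state with the same `mu`, so the quadratic terms cancel and only the
  -- ℓ¹ norms are compared.
  have h1 := hmin x hx mu (phi - mu + eta) (by abel)
  unfold progCost at h1
  have h2 : ∑ q, ‖nu q‖ ≤ ∑ q, ‖(phi - mu + eta) q‖ :=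
    le_of_mul_le_mul_left (by linarith) hγ
  -- On `I` the reverse triangle inequality absorbs the arbitrary `eta`; off `I`, where `eta = 0`,
  -- it costs twice `‖phi - mu‖`.
  have h3 := sum_norm_le_signed_sum hcard hI u
  have h4 : ∀ q : Fin m × Fin n,
      (if q.1 ∈ I then -1 else 1) * ‖(canon J D q.1 *ᵥ u) q.2‖
        ≤ ‖nu q‖ - ‖(phi - mu + eta) q‖ + 2 * (‖phi q‖ + ‖mu q‖) := by
    intro q
    have hq : nu q = (phi - mu + eta) q - (canon J D q.1 *ᵥ u) q.2 := by
      rw [hnu, Pi.sub_apply, hH, stack_mul_mulVec_apply]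
    have h5 := norm_nonneg (phi q)
    have h6 := norm_nonneg (mu q)
    have h7 := norm_sub_le (phi q) (mu q)
    rw [hq]
    split_ifs with hi
    · have h8 := norm_sub_norm_le ((phi - mu + eta) q) ((canon J D q.1 *ᵥ u) q.2)
      linarith
    · have h8 := norm_sub_norm_le ((canon J D q.1 *ᵥ u) q.2) ((phi - mu + eta) q)
      rw [norm_sub_rev] at h8
      have h9 : ‖(phi - mu + eta) q‖ = ‖phi q - mu q‖ := by
        rw [Pi.add_apply, heta q hi, add_zero, Pi.sub_apply]
      linarith
  have h5 := Finset.sum_le_sum fun q (_ : q ∈ Finset.univ) => h4 q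
  rw [Finset.sum_add_distrib, Finset.sum_sub_distrib, ← Finset.mul_sum,
    Finset.sum_add_distrib] at h5
  linarith

end ConvexProgram

/-! ### Sequences bounded in L². -/

section BoundedInL2

variable {Ω E : Type*} [MeasurableSpace Ω] [NormedAddCommGroup E] {μ : Measure Ω}

/-- A sequence of random variables that is bounded in `L²`. -/
def IsL2Bounded (μ : Measure Ω) (f : ℕ → Ω → E) : Prop :=
  (∀ k, AEStronglyMeasurable (f k) μ) ∧ ∃ b : ℝ≥0, ∀ k, eLpNorm (f k) 2 μ ≤ b

theorem IsL2Bounded.add {f g : ℕ → Ω → E} (hf : IsL2Bounded μ f) (hg : IsL2Bounded μ g) :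
    IsL2Bounded μ fun k ω => f k ω + g k ω := by
  obtain ⟨hfm, b, hb⟩ := hf
  obtain ⟨hgm, c, hc⟩ := hg
  refine ⟨fun k => (hfm k).add (hgm k), b + c, fun k => ?_⟩
  rw [ENNReal.coe_add]
  exact (eLpNorm_add_le (hfm k) (hgm k) one_le_two).trans (add_le_add (hb k) (hc k))

theorem IsL2Bounded.const_mul {𝕜 : Type*} [RCLike 𝕜] {f : ℕ → Ω → 𝕜} (hf : IsL2Bounded μ f)
    (a : 𝕜) : IsL2Bounded μ fun k ω => a * f k ω := by
  obtain ⟨hfm, b, hb⟩ := hf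
  refine ⟨fun k => (hfm k).const_mul a, ‖a‖₊ * b, fun k => ?_⟩
  rw [ENNReal.coe_mul]
  exact (eLpNorm_const_smul_le (c := a) (f := f k)).trans (mul_le_mul_right (hb k) _)

theorem isL2Bounded_of_memLp {f : Ω → E} (hf : MemLp f 2 μ) : IsL2Bounded μ fun _ : ℕ => f :=
  ⟨fun _ => hf.1, (eLpNorm f 2 μ).toNNReal, fun _ => (ENNReal.coe_toNNReal hf.2.ne).ge⟩

theorem isL2Bounded_const [IsFiniteMeasure μ] (a : E) : IsL2Bounded μ fun _ _ => a :=
  isL2Bounded_of_memLp (memLp_const a)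

theorem IsL2Bounded.sum {ι : Type*} (s : Finset ι) {f : ι → ℕ → Ω → E}
    (hf : ∀ i ∈ s, IsL2Bounded μ (f i)) : IsL2Bounded μ fun k ω => ∑ i ∈ s, f i k ω := by
  classical
  induction s using Finset.induction_on with
  | empty =>
    exact ⟨fun k => by simpa using aestronglyMeasurable_const, 0, fun k => by simp⟩
  | insert i s hi ih =>
    simp only [Finset.sum_insert hi]
    exact (hf i (Finset.mem_insert_self i s)).add
      (ih fun j hj => hf j (Finset.mem_insert_of_mem hj))

theorem IsL2Bounded.norm {f : ℕ → Ω → E} (hf : IsL2Bounded μ f) :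
    IsL2Bounded μ fun k ω => ‖f k ω‖ := by
  obtain ⟨hfm, b, hb⟩ := hf
  exact ⟨fun k => (hfm k).norm, b, fun k => (eLpNorm_norm (f k)).trans_le (hb k)⟩

/-- A stable scalar recursion preserves boundedness in `L²`. -/
theorem isL2Bounded_of_recursion {f xi : ℕ → Ω → ℂ} {ρ : ℂ} (hρ : ‖ρ‖ < 1)
    (h0 : IsL2Bounded μ fun _ : ℕ => f 0) (hxi : IsL2Bounded μ xi)
    (hrec : ∀ k ω, f (k + 1) ω = ρ * f k ω + xi k ω) : IsL2Bounded μ f := by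
  obtain ⟨hm0, b, hb⟩ := h0
  obtain ⟨hm, c, hc⟩ := hxi
  have hrec' : ∀ k, f (k + 1) = ρ • f k + xi k := fun k => funext (hrec k)
  have hmeas : ∀ k, AEStronglyMeasurable (f k) μ := by
    intro k
    induction k with
    | zero => exact hm0 0
    | succ k ih =>
      rw [hrec']
      exact (ih.const_smul ρ).add (hm k)
  have hρ' : ‖ρ‖₊ < 1 := hρ
  -- `c / (1 - ‖ρ‖₊)` is the fixed point of `t ↦ ‖ρ‖₊ t + c`, and `b` covers the start.
  refine ⟨hmeas, b + c / (1 - ‖ρ‖₊), fun k => ?_⟩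
  induction k with
  | zero =>
    exact (hb 0).trans (ENNReal.coe_le_coe.2 le_self_add)
  | succ k ih =>
    rw [hrec']
    refine (eLpNorm_add_le ((hmeas k).const_smul ρ) (hm k) one_le_two).trans ?_
    refine (add_le_add (eLpNorm_const_smul_le.trans (mul_le_mul_right ih _)) (hc k)).trans ?_
    rw [enorm_eq_nnnorm, ← ENNReal.coe_mul, ← ENNReal.coe_add, ENNReal.coe_le_coe,
      ← NNReal.coe_le_coe]
    push_cast [NNReal.coe_sub hρ'.le]
    have h1 : 0 < 1 - ‖ρ‖ := by linarith
    have h2 : (0 : ℝ) ≤ b := NNReal.coe_nonneg _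
    have h3 : ‖ρ‖ * ((c : ℝ) / (1 - ‖ρ‖)) + c = c / (1 - ‖ρ‖) := by
      field_simp
      ring
    nlinarith

theorem IsL2Bounded.exists_lintegral_le {f : ℕ → Ω → E} (hf : IsL2Bounded μ f) :
    ∃ b : ℝ≥0, ∀ k, ∫⁻ ω, ‖f k ω‖ₑ ^ 2 ∂μ ≤ b := by
  obtain ⟨-, b, hb⟩ := hf
  refine ⟨b ^ 2, fun k => ?_⟩
  have h := eLpNorm_nnreal_pow_eq_lintegral (μ := μ) (f := f k) (p := 2) two_ne_zero
  simp only [NNReal.coe_ofNat, ENNReal.rpow_ofNat, ENNReal.coe_ofNat] at h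
  rw [← h, ENNReal.coe_pow]
  exact pow_le_pow_left' (hb k) 2

theorem memLp_coord_multivariateGaussian {l : ℕ} (S : Matrix (Fin l) (Fin l) ℝ) (i : Fin l) :
    MemLp (fun x : EuclideanSpace ℝ (Fin l) => (x i : ℂ)) 2 (multivariateGaussian 0 S) := by
  refine MemLp.mono (g := id) (IsGaussian.memLp_id _ 2 (by simp)) ?_
    (ae_of_all _ fun x => ?_)
  · exact (by fun_prop : Continuous fun x : EuclideanSpace ℝ (Fin l) => (x i : ℂ)).aestronglyMeasurable
  · rw [Complex.norm_real]
    exact PiLp.norm_apply_le x i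

theorem isL2Bounded_coord {l : ℕ} {S : Matrix (Fin l) (Fin l) ℝ} {f : ℕ → Ω → Fin l → ℝ}
    (hf : ∀ k, HasLaw (fun ω => WithLp.toLp 2 (f k ω)) (multivariateGaussian 0 S) μ) (i : Fin l) :
    IsL2Bounded μ fun k ω => (f k ω i : ℂ) := by
  have h := memLp_coord_multivariateGaussian S i
  have h1 : ∀ k, AEStronglyMeasurable (fun x : EuclideanSpace ℝ (Fin l) => (x i : ℂ))
      (μ.map fun ω => WithLp.toLp 2 (f k ω)) := fun k => by
    rw [(hf k).map_eq]
    exact h.1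
  refine ⟨fun k => (h1 k).comp_aemeasurable (hf k).aemeasurable,
    (eLpNorm (fun x : EuclideanSpace ℝ (Fin l) => (x i : ℂ)) 2 (multivariateGaussian 0 S)).toNNReal,
    fun k => ?_⟩
  have h2 := eLpNorm_map_measure (p := 2) (h1 k) (hf k).aemeasurable
  rw [(hf k).map_eq] at h2
  exact h2.symm.trans_le (ENNReal.coe_toNNReal h.2.ne).ge

end BoundedInL2

/-! ### Attack-free errors of the local estimates. -/

section LocalError

variable {m n : ℕ} {Ω : Type*} {A : Matrix (Fin n) (Fin n) ℝ} {C : Matrix (Fin m) (Fin n) ℝ}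
  {ev : Fin n → ℂ} {x0 : Ω → Fin n → ℝ} {w : ℕ → Ω → Fin n → ℝ} {v : ℕ → Ω → Fin m → ℝ}

/-- Rests on the resolvent identity `A (A - π)⁻¹ A = π A (A - π)⁻¹ + A`, the reason for the form of
`G`. -/
theorem G_mulVec_mulVec {j : Fin n} (hj : ev j ∉ spectrum ℂ (cpx A)) (i : Fin m)
    (x : Fin n → ℂ) : (G A C ev i *ᵥ (cpx A *ᵥ x)) j
      = ev j * (G A C ev i *ᵥ x) j + cpx C i ⬝ᵥ (cpx A *ᵥ x) := by
  have h1 : ∀ y, (G A C ev i *ᵥ y) j = cpx C i ⬝ᵥ ((cpx A * (cpx A - ev j • 1)⁻¹) *ᵥ y) :=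
    fun y => by
      rw [dotProduct_mulVec]
      rfl
  have h2 : cpx A * (cpx A - ev j • 1)⁻¹ * cpx A
      = ev j • (cpx A * (cpx A - ev j • 1)⁻¹) + cpx A := by
    have h3 : cpx A * (cpx A - ev j • 1)⁻¹ * (cpx A - ev j • 1) = cpx A := by
      rw [Matrix.mul_assoc, Matrix.nonsing_inv_mul _ (isUnit_det_sub_smul_one hj), Matrix.mul_one]
    rw [Matrix.mul_sub, Matrix.mul_smul, Matrix.mul_one, sub_eq_iff_eq_add] at h3
    conv_lhs => rw [h3]
    rw [add_comm]
  rw [h1, h1, Matrix.mulVec_mulVec, h2, Matrix.add_mulVec, dotProduct_add, Matrix.smul_mulVec,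
    dotProduct_smul, smul_eq_mul]

/-- The error of a local estimate with respect to `G_i x(k)`. -/
noncomputable def localErr (A : Matrix (Fin n) (Fin n) ℝ) (C : Matrix (Fin m) (Fin n) ℝ) (ev s r : Fin n → ℂ)
    (x0 : Ω → Fin n → ℝ) (w : ℕ → Ω → Fin n → ℝ) (v : ℕ → Ω → Fin m → ℝ) (i : Fin m) (k : ℕ)
    (ω : Ω) : Fin n → ℂ :=
  localEst ev s r (fun t => trueMeas A C x0 w v t ω i) k
    - G A C ev i *ᵥ fun l => (state A x0 w k ω l : ℂ)

theorem cpx_mulVec_ofReal {k l : ℕ} (N : Matrix (Fin k) (Fin l) ℝ) (x : Fin l → ℝ) (i : Fin k) :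
    (((N *ᵥ x) i : ℝ) : ℂ) = (cpx N *ᵥ fun j => (x j : ℂ)) i := by
  simp [Matrix.mulVec, dotProduct, cpx]

/-- The state cancels, so the error is driven by noise only and stays bounded even if `A` is
unstable. -/
theorem localErr_succ {s r : Fin n → ℂ} {i : Fin m} {j : Fin n}
    (hj : ev j ∉ spectrum ℂ (cpx A)) (k : ℕ) (ω : Ω) :
    localErr A C ev s r x0 w v i (k + 1) ω j = ev j * localErr A C ev s r x0 w v i k ω j
      + ((v (k + 1) ω i : ℂ) + ∑ l, (cpx C i l - G A C ev i j l) * (w k ω l : ℂ)) := by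
  have h1 : (fun l => (state A x0 w (k + 1) ω l : ℂ))
      = cpx A *ᵥ (fun l => (state A x0 w k ω l : ℂ)) + fun l => (w k ω l : ℂ) := by
    ext l
    rw [Pi.add_apply, ← cpx_mulVec_ofReal, ← Complex.ofReal_add]
    rfl
  have h2 : (trueMeas A C x0 w v (k + 1) ω i : ℂ)
      = cpx C i ⬝ᵥ (fun l => (state A x0 w (k + 1) ω l : ℂ)) + (v (k + 1) ω i : ℂ) := by
    rw [trueMeas, Pi.add_apply, Complex.ofReal_add, cpx_mulVec_ofReal]
    rfl
  have h3 : ∑ l, (cpx C i l - G A C ev i j l) * (w k ω l : ℂ)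
      = cpx C i ⬝ᵥ (fun l => (w k ω l : ℂ)) - (G A C ev i *ᵥ fun l => (w k ω l : ℂ)) j := by
    simp only [sub_mul, Finset.sum_sub_distrib]
    rfl
  rw [h3, localErr, localErr, Pi.sub_apply, Pi.sub_apply, localEst, h2, h1, Matrix.mulVec_add,
    Pi.add_apply, G_mulVec_mulVec hj, dotProduct_add]
  ring

variable [MeasurableSpace Ω] {μ : Measure Ω} [IsProbabilityMeasure μ]
  {Q S0 : Matrix (Fin n) (Fin n) ℝ} {R : Matrix (Fin m) (Fin m) ℝ}

theorem isL2Bounded_localErr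
    (hx0 : HasLaw (fun ω => WithLp.toLp 2 (x0 ω)) (multivariateGaussian 0 S0) μ)
    (hw : ∀ k, HasLaw (fun ω => WithLp.toLp 2 (w k ω)) (multivariateGaussian 0 Q) μ)
    (hv : ∀ k, HasLaw (fun ω => WithLp.toLp 2 (v k ω)) (multivariateGaussian 0 R) μ)
    (s r : Fin n → ℂ) (i : Fin m) {j : Fin n} (hj : ev j ∉ spectrum ℂ (cpx A))
    (hj1 : ‖ev j‖ < 1) :
    IsL2Bounded μ fun k ω => localErr A C ev s r x0 w v i k ω j := by
  refine isL2Bounded_of_recursion hj1 ?_ ?_ fun k ω => localErr_succ hj k ω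
  · have h1 : (fun ω => localErr A C ev s r x0 w v i 0 ω j) = fun ω =>
        (s j + r j * ((∑ l, cpx C i l * (x0 ω l : ℂ)) + (v 0 ω i : ℂ)))
          + ∑ l, -G A C ev i j l * (x0 ω l : ℂ) := by
      ext ω
      rw [localErr, Pi.sub_apply, localEst, trueMeas, Pi.add_apply, Complex.ofReal_add,
        cpx_mulVec_ofReal]
      simp only [neg_mul, Finset.sum_neg_distrib, ← sub_eq_add_neg]
      rfl
    rw [h1]
    have hx : ∀ l, IsL2Bounded μ fun (_ : ℕ) ω => (x0 ω l : ℂ) := isL2Bounded_coord fun _ => hx0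
    exact ((isL2Bounded_const _).add (((IsL2Bounded.sum _ fun l _ => (hx l).const_mul _).add
      (isL2Bounded_coord (fun _ => hv 0) i)).const_mul _)).add
        (IsL2Bounded.sum _ fun l _ => (hx l).const_mul _)
  · exact (isL2Bounded_coord (fun k => hv (k + 1)) i).add
      (IsL2Bounded.sum _ fun l _ => (isL2Bounded_coord hw l).const_mul _)

end LocalError

/-! ### From the deterministic bound to security. -/

section Security

variable {m n : ℕ} {Ω : Type*} {A : Matrix (Fin n) (Fin n) ℝ} {C : Matrix (Fin m) (Fin n) ℝ}
  {ev : Fin n → ℂ} {x0 : Ω → Fin n → ℝ} {w : ℕ → Ω → Fin n → ℝ} {v : ℕ → Ω → Fin m → ℝ}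
  {T J : Matrix (Fin n) (Fin n) ℂ} {U : Fin m → Matrix (Fin n) (Fin n) ℂ}

theorem IsTransform.mul_G (hU : IsTransform A C ev T J U) (hT : IsUnit T.det) (i : Fin m) :
    U i * G A C ev i = canon J (cpx C * T) i * T⁻¹ := by
  rw [← (hU i).2, Matrix.mul_assoc, Matrix.mul_assoc, Matrix.mul_nonsing_inv _ hT, Matrix.mul_one]

/-- Without attack the data are the canonical outputs of the state plus transformed errors. -/
theorem progData_trueMeas (hU : IsTransform A C ev T J U) (hT : IsUnit T.det)
    (s r : Fin m → Fin n → ℂ) (k : ℕ) (ω : Ω) :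
    progData ev s r U (fun t => trueMeas A C x0 w v t ω) k
      = (stack (canon J (cpx C * T)) * T⁻¹) *ᵥ (fun l => (state A x0 w k ω l : ℂ))
        + fun q => (U q.1 *ᵥ localErr A C ev (s q.1) (r q.1) x0 w v q.1 k ω) q.2 := by
  ext q
  rw [Pi.add_apply, stack_mul_mulVec_apply, Matrix.mulVec_mulVec, ← hU.mul_G hT, localErr,
    Matrix.mulVec_sub, Pi.sub_apply, Matrix.mulVec_mulVec, add_sub_cancel]
  rfl

theorem progData_congr {y y' : ℕ → Fin m → ℝ} {s r : Fin m → Fin n → ℂ} {q : Fin m × Fin n}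
    (h : ∀ t, y t q.1 = y' t q.1) (k : ℕ) :
    progData ev s r U y k q = progData ev s r U y' k q := by
  have : (fun t => y t q.1) = fun t => y' t q.1 := funext h
  rw [progData, progData, this]

/-- A vector is controlled by the `ℓ¹` norm of its coordinates with respect to a basis. -/
theorem exists_norm_toLp_le (hT : IsUnit T.det) : ∃ c : ℝ, 0 ≤ c ∧ ∀ x : Fin n → ℂ,
    ‖WithLp.toLp 2 x‖ ≤ c * ∑ j, ‖(T⁻¹ *ᵥ x) j‖ := by
  let L : (Fin n → ℂ) →L[ℂ] EuclideanSpace ℂ (Fin n) := LinearMap.toContinuousLinearMap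
    ((WithLp.linearEquiv 2 ℂ (Fin n → ℂ)).symm.toLinearMap ∘ₗ T.mulVecLin)
  refine ⟨‖L‖, norm_nonneg _, fun x => ?_⟩
  have h : WithLp.toLp 2 x = L (T⁻¹ *ᵥ x) := by
    show WithLp.toLp 2 x = WithLp.toLp 2 (T *ᵥ (T⁻¹ *ᵥ x))
    rw [Matrix.mulVec_mulVec, Matrix.mul_nonsing_inv _ hT, Matrix.one_mulVec]
  rw [h]
  exact (L.le_opNorm _).trans
    (mul_le_mul_of_nonneg_left (norm_le_sum_norm _) (norm_nonneg _))

open Classical in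
open scoped ComplexOrder in
theorem isSecure_of_isProgSol [MeasurableSpace Ω] {μ : Measure Ω} [IsProbabilityMeasure μ]
    {Q S0 : Matrix (Fin n) (Fin n) ℝ} {R : Matrix (Fin m) (Fin m) ℝ}
    (hx0 : HasLaw (fun ω => WithLp.toLp 2 (x0 ω)) (multivariateGaussian 0 S0) μ)
    (hw : ∀ k, HasLaw (fun ω => WithLp.toLp 2 (w k ω)) (multivariateGaussian 0 Q) μ)
    (hv : ∀ k, HasLaw (fun ω => WithLp.toLp 2 (v k ω)) (multivariateGaussian 0 R) μ)
    (hevA : ∀ j, ev j ∉ spectrum ℂ (cpx A)) (hev1 : ∀ j, ‖ev j‖ < 1) (hT : IsUnit T.det)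
    {γ : ℝ} (hγ : 0 < γ) {X : Submodule ℝ (Fin n → ℂ)}
    (hX : ∀ x : Fin n → ℝ, (fun j => (x j : ℂ)) ∈ X) {p : ℕ}
    (hcard : ∀ j, 2 * p < (Finset.univ.filter fun i => i ∈ observers J (cpx C * T) j).card)
    (hU : IsTransform A C ev T J U) {M : Matrix (Fin m × Fin n) (Fin m × Fin n) ℂ}
    (hM : M.PosDef) {s r : Fin m → Fin n → ℂ}
    {g : (k : ℕ) → (Fin (k + 1) → Fin m → ℝ) → Fin n → ℂ}
    (hg : ∀ (k : ℕ) (y : ℕ → Fin m → ℝ), ∃ mu nu,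
      IsProgSol X γ M (stack (canon J (cpx C * T)) * T⁻¹) (progData ev s r U y k)
        (g k (hist y k)) mu nu) :
    IsSecure μ (trueMeas A C x0 w v) p g := by
  obtain ⟨b, hb0, hb⟩ := exists_norm_le_of_isProgSol (X := X)
    (H := stack (canon J (cpx C * T)) * T⁻¹) hγ hM
  obtain ⟨c, hc0, hc⟩ := exists_norm_toLp_le hT
  let phi : ℕ → Ω → Fin m × Fin n → ℂ := fun k ω q =>
    (U q.1 *ᵥ localErr A C ev (s q.1) (r q.1) x0 w v q.1 k ω) q.2
  have hphi : ∀ q, IsL2Bounded μ fun k ω => phi k ω q := fun q =>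
    IsL2Bounded.sum Finset.univ
      (f := fun j k ω => U q.1 q.2 j * localErr A C ev (s q.1) (r q.1) x0 w v q.1 k ω j) fun j _ =>
      (isL2Bounded_localErr hx0 hw hv (s q.1) (r q.1) q.1 (hevA j) (hev1 j)).const_mul _
  -- The factor `4`: each of the two estimates is within `2 * (∑ ‖phi‖ + b)` of the state in the
  -- coordinates of `T`.
  have hF : IsL2Bounded μ fun k ω => c * (4 * ((∑ q, ‖phi k ω q‖) + b)) :=
    (((IsL2Bounded.sum _ fun q _ => (hphi q).norm).add (isL2Bounded_const b)).const_mul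
      (4 : ℝ)).const_mul c
  obtain ⟨B, hB⟩ := hF.exists_lintegral_le
  -- `B` is fixed before the attack. The domination is pointwise in `ω`, so no measurability of `a`
  -- or `g` enters.
  refine ⟨B, fun a ⟨I, hI, ha⟩ => iSup_le fun k => (lintegral_mono fun ω => ?_).trans (hB k)⟩
  -- One bound serves both data sets: each agrees with the true measurements off `I`, so the data
  -- deviation is supported on `I`.
  have key : ∀ y : ℕ → Fin m → ℝ, (∀ t, ∀ i ∉ I, y t i = trueMeas A C x0 w v t ω i) →
      ∑ j, ‖(T⁻¹ *ᵥ (g k (hist y k) - fun l => (state A x0 w k ω l : ℂ))) j‖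
        ≤ 2 * ((∑ q, ‖phi k ω q‖) + b) := by
    intro y hy
    obtain ⟨mu, nu, h⟩ := hg k y
    have hmu := hb _ _ _ _ h
    have hdata : progData ev s r U y k
        = (stack (canon J (cpx C * T)) * T⁻¹) *ᵥ (fun l => (state A x0 w k ω l : ℂ)) + phi k ω
          + (progData ev s r U y k
            - progData ev s r U (fun t => trueMeas A C x0 w v t ω) k) := by
      rw [progData_trueMeas hU hT]
      exact (add_sub_cancel _ _).symm
    rw [hdata] at h
    refine (h.sum_norm_sub_le hγ hcard hI.le (hX _) fun q hq => ?_).trans (by gcongr)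
    rw [Pi.sub_apply, progData_congr (fun t => hy t q.1 hq), sub_self]
  have h1 := key (fun t => trueMeas A C x0 w v t ω) fun _ _ _ => rfl
  have h2 := key (fun t => trueMeas A C x0 w v t ω + a t ω) fun t i hi => by
    rw [Pi.add_apply, not_imp_comm.1 (ha t ω i) hi, add_zero]
  refine pow_le_pow_left' (enorm_le_iff_norm_le.2 ?_) 2
  refine (hc _).trans ?_
  rw [Real.norm_of_nonneg (by positivity)]
  refine mul_le_mul_of_nonneg_left ?_ hc0
  rw [← sub_sub_sub_cancel_right _ _ fun l => (state A x0 w k ω l : ℂ), Matrix.mulVec_sub]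
  refine (Finset.sum_le_sum fun j _ => norm_sub_le _ _).trans ?_
  rw [Finset.sum_add_distrib]
  linarith

end Security

end SecureEst

/-! ### The theorem. -/

theorem mainTheorem5 {m n : ℕ} {Ω : Type*} [MeasurableSpace Ω] (μ : Measure Ω)
    [IsProbabilityMeasure μ]
    -- the system, its noises and initial state
    (A : Matrix (Fin n) (Fin n) ℝ) (C : Matrix (Fin m) (Fin n) ℝ)
    (Q S0 : Matrix (Fin n) (Fin n) ℝ) (R : Matrix (Fin m) (Fin m) ℝ)
    (hQ : Q.PosSemidef) (hS0 : S0.PosSemidef) (hR : R.PosDef)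
    (x0 : Ω → Fin n → ℝ) (w : ℕ → Ω → Fin n → ℝ) (v : ℕ → Ω → Fin m → ℝ)
    (hx0 : HasLaw (fun ω => WithLp.toLp 2 (x0 ω)) (multivariateGaussian 0 S0) μ)
    (hw : ∀ k, HasLaw (fun ω => WithLp.toLp 2 (w k ω)) (multivariateGaussian 0 Q) μ)
    (hv : ∀ k, HasLaw (fun ω => WithLp.toLp 2 (v k ω)) (multivariateGaussian 0 R) μ)
    (hw_indep : iIndepFun w μ) (hv_indep : iIndepFun v μ)
    (hx0_indep : IndepFun x0 (fun ω k => w k ω) μ)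
    -- the steady-state Kalman filter
    (P : Matrix (Fin n) (Fin n) ℝ)
    (hP : Tendsto (SecureEst.postCov A C Q R S0) atTop (𝓝 P))
    -- the eigenvalues `ev` of `A - K C A` are distinct and are not eigenvalues of `A`
    (V : Matrix (Fin n) (Fin n) ℂ) (ev : Fin n → ℂ) (hV : IsUnit V.det)
    (hdiag : SecureEst.cpx (SecureEst.closedLoop A C Q R P) = V * Matrix.diagonal ev * V⁻¹)
    (hev : Function.Injective ev) (hevA : ∀ j, ev j ∉ spectrum ℂ (SecureEst.cpx A))
    -- `A` is non-singular with geometric multiplicities one; `J` is its Jordan form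
    (hA : IsUnit A.det) (T J : Matrix (Fin n) (Fin n) ℂ) (hT : IsUnit T.det)
    (hJ : SecureEst.IsNonderogatoryJordan J) (hAJ : SecureEst.cpx A = T * J * T⁻¹)
    -- the parameter and the range of the decision variable of the convex program
    (γ : ℝ) (hγ : 0 < γ) (X : Submodule ℝ (Fin n → ℂ))
    (hX : ∀ x : Fin n → ℝ, (fun j => (x j : ℂ)) ∈ X)
    -- sparse observability
    (p s : ℕ) (hs : SecureEst.IsSparseObsIndex A C s) (hps : 2 * p ≤ s) :
    (∃! W, SecureEst.IsLyapunovSol A C Q R ev W) ∧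
    (∃ U, SecureEst.IsTransform A C ev T J U) ∧
    ∀ W, SecureEst.IsLyapunovSol A C Q R ev W → ∀ U, SecureEst.IsTransform A C ev T J U →
      ∀ M, M = SecureEst.blockDiag U * W * (SecureEst.blockDiag U)ᴴ →
      ∀ H, H = SecureEst.stack (SecureEst.canon J (SecureEst.cpx C * T)) * T⁻¹ →
        (∀ Y, ∃ x mu nu, SecureEst.IsProgSol X γ M H Y x mu nu) ∧
        ∀ (a₀ b₀ : Fin m → Fin n → ℂ)
          (g : (k : ℕ) → (Fin (k + 1) → Fin m → ℝ) → Fin n → ℂ),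
          (∀ (k : ℕ) (y : ℕ → Fin m → ℝ), ∃ mu nu,
            SecureEst.IsProgSol X γ M H (SecureEst.progData ev a₀ b₀ U y k)
              (g k (SecureEst.hist y k)) mu nu) →
          SecureEst.IsSecure μ (SecureEst.trueMeas A C x0 w v) p g := by
  have hev1 := SecureEst.norm_eigenvalue_lt_one hQ hS0 hR hP hV hdiag hevA
  refine ⟨SecureEst.existsUnique_isLyapunovSol hev1,
    SecureEst.exists_isTransform hA hev hevA hT hJ hAJ, ?_⟩
  rintro W hW U hU M rfl H rfl
  have hM := SecureEst.posDef_conj_blockDiag (fun i => (hU i).1)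
    (SecureEst.posDef_of_isLyapunovSol hQ hR hev hev1 hW)
  refine ⟨SecureEst.exists_isProgSol hγ hM, fun a₀ b₀ g hg => ?_⟩
  exact SecureEst.isSecure_of_isProgSol hx0 hw hv hevA hev1 hT hγ hX
    (fun j => hps.trans_lt (hs.lt_card_observers hT hAJ j)) hU hM hg
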